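/- A \emph{plane-bipartite graph} $G$ is a finite undirected graph (parallel edges allowed) drawn without crossings inside a disk, with $n\ge 0$ boundary vertices $b_1,\dots,b_n$ on the boundary of the disk, labelled clockwise, and with internal vertices strictly inside the disk, each coloured black or white, such that no edge joins a vertex to itself or joins two internal vertices of the same colour, and each boundary vertex is incident to exactly one edge. The edges are simple arcs that lie strictly inside the disk except at endpoints that are boundary vertices. An \emph{almost perfect matching} of $G$ is a set $M$ of edges such that each internal vertex is incident to exactly one edge of $M$ (boundary vertices may be incident to one or none). The polytope $P(G)\subset\mathbb{R}^{E(G)}$ is the convex hull of the $0$-$1$ indicator vectors of all almost perfect matchings of $G$, and $\mathrm{Faces}(G)$ is the set of connected components of the complement of $G$ in the disk. Suppose that $G$ has at least one almost perfect matching and that every edge of $G$ is used in some almost perfect matching. Then $\mathrm{Faces}(G)$ is finite and $P(G)$ (that is, its affine hull) has dimension $\#\mathrm{Faces}(G)-1$. The graph $G$ need not be connected, and some of its components may contain no boundary vertex. -/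

import Mathlib

/-- The two colours of internal vertices. -/
inductive VertexColor
  | black
  | white

/-- A plane-bipartite graph with boundary vertices `b_0, …, b_{n-1}`, internal vertex set `V` and
edge set `E`, drawn in the closed unit disk of `ℂ`. Parallel edges are allowed. Vertices are
`V ⊕ Fin n`: `Sum.inl v` is internal and coloured, `Sum.inr i` is the `i`-th boundary vertex and
is not coloured. -/
structure PlaneBipartiteGraph (n : ℕ) (V E : Type*) where
  /-- The colour of an internal vertex. -/
  color : V → VertexColor
  /-- The unordered pair of endpoints of an edge. -/
  ends : E → Sym2 (V ⊕ Fin n)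
  /-- The two endpoints of an edge are distinct. -/
  ends_not_isDiag : ∀ e, ¬ (ends e).IsDiag
  /-- An edge between internal vertices joins vertices of different colours. -/
  color_ne : ∀ e u v, ends e = s(Sum.inl u, Sum.inl v) → color u ≠ color v
  /-- Each boundary vertex is incident to a single edge. -/
  boundary_single : ∀ i : Fin n, ∃! e, Sum.inr i ∈ ends e
  /-- The position of an internal vertex. -/
  pos : V → ℂ
  pos_injective : Function.Injective pos
  /-- Internal vertices lie strictly inside the disk. -/
  norm_pos_lt : ∀ v, ‖pos v‖ < 1
  /-- The boundary vertex `b_i` is drawn at `exp (angle i * I)` on the unit circle. -/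
  angle : Fin n → ℝ
  /-- The boundary vertices are distinct and labelled in clockwise order. -/
  angle_strictAnti : StrictAnti angle
  angle_lt : ∀ i j, angle i < angle j + 2 * Real.pi
  /-- The curve that draws an edge (parametrized in one of its two directions). -/
  curve : E → C(unitInterval, ℂ)
  /-- Each edge is drawn as a simple arc. -/
  curve_injective : ∀ e, Function.Injective (curve e)
  /-- The arc of `e` joins the positions of the two endpoints of `e`. -/
  curve_ends : ∀ e, s(curve e 0, curve e 1) =
    (ends e).map (Sum.elim pos fun i => Complex.exp (angle i * Complex.I))
  /-- Apart from its endpoints, an arc lies strictly inside the disk. -/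
  norm_curve_lt : ∀ e t, t ≠ 0 → t ≠ 1 → ‖curve e t‖ < 1
  /-- An arc meets internal vertices only in its endpoints. -/
  curve_eq_pos : ∀ e t v, curve e t = pos v → t = 0 ∨ t = 1
  /-- Two different arcs meet only in common endpoints. -/
  curve_eq_curve : ∀ e f, e ≠ f → ∀ s t, curve e s = curve f t →
    (s = 0 ∨ s = 1) ∧ (t = 0 ∨ t = 1)

namespace PlaneBipartiteGraph

variable {n : ℕ} {V E : Type*}

/-- The position of a vertex, internal or boundary, in the closed unit disk. -/
noncomputable def point (G : PlaneBipartiteGraph n V E) : V ⊕ Fin n → ℂ :=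
  Sum.elim G.pos fun i => Complex.exp (G.angle i * Complex.I)

/-- The subset of the closed unit disk covered by the vertices and edges of `G`. -/
def support (G : PlaneBipartiteGraph n V E) : Set ℂ :=
  Set.range G.point ∪ ⋃ e, Set.range (G.curve e)

/-- The faces of `G`: the connected components of the complement of `G` in the (open) disk. -/
def Faces (G : PlaneBipartiteGraph n V E) : Type :=
  ConnectedComponents ↥(Metric.ball (0 : ℂ) 1 \ G.support)

/-- An almost perfect matching: a set of edges such that each internal vertex is incident to
exactly one of them (no condition at boundary vertices). -/
def IsAlmostPerfectMatching (G : PlaneBipartiteGraph n V E) (M : Set E) : Prop :=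
  ∀ v : V, ∃! e, e ∈ M ∧ Sum.inl v ∈ G.ends e

/-- The matching polytope `P(G)`: the convex hull in `ℝ^E` of the 0-1 vectors of the almost
perfect matchings of `G`. -/
noncomputable def matchingPolytope (G : PlaneBipartiteGraph n V E) : Set (E → ℝ) :=
  convexHull ℝ {x | ∃ M : Set E, G.IsAlmostPerfectMatching M ∧ x = M.indicator 1}

/-- The dimension of `P(G)` (as a nonempty set): the dimension of the direction of its affine
hull. -/
noncomputable def polytopeDim (G : PlaneBipartiteGraph n V E) : ℕ :=
  Module.finrank ℝ (affineSpan ℝ G.matchingPolytope).direction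

end PlaneBipartiteGraph

/-!
The dimension of the matching polytope is computed as the dimension of the solution space of the
homogeneous vertex equations, and the number of faces as a first cohomology group; both are
determined by the incidence matrix of the internal vertices.

*The polytope.* The matching polytope is cut out by the inequalities `0 ≤ x ≤ 1` and the equations
that the edges at each internal vertex have total weight one (`matchingPolytope_eq`): at an
extreme point the non-integral edges would carry a nonzero solution of the homogeneous equations,
by a count of dimensions that uses the colouring (`exists_mulVec_eq_zero`). The average of all
almost perfect matchings satisfies the inequalities strictly as far as these do not follow from
the equations, so the directions of the affine hull are all solutions of the homogeneous equations
(`direction_affineSpan_matchingPolytope`). Changing signs by the colours turns the transposed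
incidence matrix into the coboundary map of the graph relative to its boundary vertices
(`rank_incidence`). So the dimension is that of the space of cochains on edges modulo
coboundaries.

*The faces.* The arcs are only continuous, so a form of Alexander duality in the plane is needed.
Its elementary version compares a compact set `K` with the group of nonvanishing continuous
functions on `K` modulo exponentials. By Eilenberg's theorem (`mem_logOn_sup_linearGroup`) this
group is generated by the functions `z - a` with `a ∉ K`. The proof cuts `K` along lines: on the
line two logarithms differ by an integer-valued function, a combination of step functions that
jump off `K`, and such a step at `a` is the jump of the logarithm of `z - a`. Moving `a` within a
component of the complement changes `z - a` by an exponential only (`linearUnit_div_mem_logOn`),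
and the functions for different bounded components are independent (`eq_zero_of_mul_mem_logOn`).
For the union of the drawing and the unit circle, a function with a logarithm on the circle is
described up to exponentials by a cochain modulo coboundaries (`exists_coboundary_eq`,
`mem_logOn_skeleton`), and all integral cochains occur (`exists_single_mem_windingGroup`). Hence
the quotients `(z - a) / (z - a₀)`, with one `a` for each face other than that of `a₀`, give a
basis of the cochains modulo coboundaries (`card_faces_eq`).
-/

namespace PlaneLog

open Complex Set

/-! ### Logarithms of nonvanishing functions on subsets of the plane -/

/-- The group of those `u : ℂ → ℂˣ` that have a continuous logarithm on `S`. Nothing is asked of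
`u` outside `S`, not even continuity. -/
def logOn (S : Set ℂ) : Subgroup (ℂ → ℂˣ) where
  carrier := {u | ∃ g : ℂ → ℂ, ContinuousOn g S ∧ ∀ z ∈ S, (u z : ℂ) = exp (g z)}
  mul_mem' := by
    rintro u v ⟨g, hg, hu⟩ ⟨k, hk, hv⟩
    exact ⟨g + k, hg.add hk, fun z hz => by simp [hu z hz, hv z hz, exp_add]⟩
  one_mem' := ⟨0, continuousOn_const, fun z _ => by simp⟩
  inv_mem' := by
    rintro u ⟨g, hg, hu⟩
    exact ⟨-g, hg.neg, fun z hz => by simp [hu z hz, exp_neg]⟩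

lemma logOn_anti {S T : Set ℂ} (h : S ⊆ T) : logOn T ≤ logOn S := by
  rintro u ⟨g, hg, hu⟩
  exact ⟨g, hg.mono h, fun z hz => hu z (h hz)⟩

lemma mem_logOn_congr {S : Set ℂ} {u v : ℂ → ℂˣ} (h : EqOn u v S) (hu : u ∈ logOn S) :
    v ∈ logOn S := by
  obtain ⟨g, hg, hu⟩ := hu
  exact ⟨g, hg, fun z hz => by rw [← h hz, hu z hz]⟩

/-- A function with values, up to a constant factor, in the slit plane has a logarithm. -/
lemma mem_logOn_of_slitPlane {S : Set ℂ} {u : ℂ → ℂˣ} (hu : ContinuousOn (fun z => (u z : ℂ)) S)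
    {w : ℂ} (hw : w ≠ 0) (h : ∀ z ∈ S, w * u z ∈ slitPlane) : u ∈ logOn S := by
  refine ⟨fun z => log (w * u z) - log w,
    ((continuousOn_const.mul hu).clog h).sub continuousOn_const, fun z hz => ?_⟩
  rw [exp_sub, exp_log (slitPlane_ne_zero (h z hz)), exp_log hw, mul_div_cancel_left₀ _ hw]

/-- The function `z ↦ z - a`, with the junk value `1` at `a`. -/
noncomputable def linearUnit (a : ℂ) : ℂ → ℂˣ := fun z =>
  if h : z - a = 0 then 1 else Units.mk0 (z - a) h

lemma linearUnit_apply {a z : ℂ} (h : z ≠ a) : (linearUnit a z : ℂ) = z - a := by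
  simp [linearUnit, sub_ne_zero.2 h]

lemma continuousOn_linearUnit {a : ℂ} {S : Set ℂ} (h : a ∉ S) :
    ContinuousOn (fun z => (linearUnit a z : ℂ)) S :=
  (continuousOn_id.sub continuousOn_const).congr fun _ hz =>
    linearUnit_apply (ne_of_mem_of_not_mem hz h)

/-- The group generated by the functions `z ↦ z - a` with `a ∉ K`. -/
noncomputable def linearGroup (K : Set ℂ) : Subgroup (ℂ → ℂˣ) :=
  Subgroup.closure (linearUnit '' Kᶜ)

lemma linearUnit_mem_linearGroup {K : Set ℂ} {a : ℂ} (h : a ∉ K) : linearUnit a ∈ linearGroup K :=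
  Subgroup.subset_closure ⟨a, h, rfl⟩

/-- `z - a` has a logarithm on a set that lies in a closed half-plane with `a` on its boundary or
outside, as long as `a` is not in the set. -/
lemma linearUnit_mem_logOn_of_halfPlane {S : Set ℂ} {a w : ℂ} (ha : a ∉ S)
    (h : ∀ z ∈ S, 0 ≤ (w * (z - a)).re) (hw : w ≠ 0) : linearUnit a ∈ logOn S := by
  refine mem_logOn_of_slitPlane (continuousOn_linearUnit ha) hw fun z hz => ?_
  have hza := ne_of_mem_of_not_mem hz ha
  rw [linearUnit_apply hza, mem_slitPlane_iff]
  rcases (h z hz).lt_or_eq with h0 | h0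
  · exact Or.inl h0
  · refine Or.inr fun him => mul_ne_zero hw (sub_ne_zero.2 hza) (Complex.ext h0.symm him)

/-! ### Integer-valued functions on compact subsets of the line -/

/-- The group of integer step functions on `ℝ` that jump only at points outside `J`. -/
def stepGroup (J : Set ℝ) : AddSubgroup (ℝ → ℤ) :=
  AddSubgroup.closure (range (fun (m : ℤ) (_ : ℝ) => m) ∪
    (fun s : ℝ => (Ici s).indicator (1 : ℝ → ℤ)) '' Jᶜ)

/-- A continuous integer-valued function on a compact subset of the line is a step function. -/
lemma exists_mem_stepGroup {J : Set ℝ} (hJ : IsCompact J) {d : ℝ → ℤ}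
    (hd : ContinuousOn (fun y => (d y : ℝ)) J) : ∃ φ ∈ stepGroup J, EqOn φ d J := by
  have huc := hJ.uniformContinuousOn_of_continuous hd
  rw [Metric.uniformContinuousOn_iff] at huc
  obtain ⟨δ, hδ, hδ'⟩ := huc 1 one_pos
  have key : ∀ x ∈ J, ∀ y ∈ J, |x - y| < δ → d x = d y := by
    intro x hx y hy hxy
    have := hδ' x hx y hy hxy
    rw [Real.dist_eq] at this
    have h2 : |d x - d y| < 1 := by exact_mod_cast this
    have := Int.abs_lt_one_iff.1 h2
    omega
  obtain ⟨R, hR⟩ := hJ.isBounded.subset_closedBall 0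
  -- Sweep from left to right in steps of `δ / 2`, keeping the step function constant to the right.
  have sweep : ∀ N : ℕ, ∃ φ ∈ stepGroup J, (∀ y ∈ J, y ≤ -R - 1 + N * (δ / 2) → φ y = d y) ∧
      ∀ y, -R - 1 + N * (δ / 2) ≤ y → φ y = φ (-R - 1 + N * (δ / 2)) := by
    intro N
    induction N with
    | zero =>
      refine ⟨0, zero_mem _, fun y hy hy' => ?_, fun _ _ => rfl⟩
      have := hR hy
      rw [Metric.mem_closedBall, dist_zero_right, Real.norm_eq_abs, abs_le] at this
      simp at hy'
      linarith
    | succ N ih =>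
      obtain ⟨φ, hφ, h1, h2⟩ := ih
      set s := -R - 1 + N * (δ / 2) with hs
      have hs' : -R - 1 + (N + 1 : ℕ) * (δ / 2) = s + δ / 2 := by rw [hs]; push_cast; ring
      rw [hs']
      by_cases hne : ∃ x ∈ J, s < x ∧ x ≤ s + δ / 2
      · obtain ⟨x, hxJ, hsx, hxs⟩ := hne
        by_cases hsJ : s ∈ J
        · refine ⟨φ, hφ, fun y hy hy' => ?_, fun y hy => ?_⟩
          · rcases le_or_gt y s with h | h
            · exact h1 y hy h
            · rw [h2 y h.le, h1 s hsJ le_rfl]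
              exact key _ hsJ _ hy (by rw [abs_lt]; constructor <;> linarith)
          · rw [h2 y (by linarith), h2 (s + δ / 2) (by linarith)]
        · refine ⟨φ + (d x - φ s) • (Ici s).indicator (1 : ℝ → ℤ), add_mem hφ (zsmul_mem
            (show _ ∈ stepGroup J from AddSubgroup.subset_closure (Or.inr ⟨s, hsJ, rfl⟩)) _),
            fun y hy hy' => ?_, fun y hy => ?_⟩
          · rcases le_or_gt s y with h | h
            · have : d x = d y := key _ hxJ _ hy (by
                have : s ≠ y := fun e => hsJ (e ▸ hy)
                rw [abs_lt]; constructor <;> linarith)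
              simp [indicator, h, h2 y h, this]
            · simp [indicator, not_le.2 h, h1 y hy h.le]
          · have e1 : s ≤ y := by linarith
            have e2 : s ≤ s + δ / 2 := by linarith
            have e3 : 0 ≤ δ / 2 := by positivity
            simp [indicator, e1, e3, h2 y e1, h2 _ e2]
      · push Not at hne
        refine ⟨φ, hφ, fun y hy hy' => ?_, fun y hy => ?_⟩
        · rcases le_or_gt y s with h | h
          · exact h1 y hy h
          · exact absurd hy' (not_le.2 (hne y hy h))
        · rw [h2 y (by linarith), h2 (s + δ / 2) (by linarith)]
  obtain ⟨N, hN⟩ := exists_nat_ge ((2 * R + 1) / (δ / 2))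
  obtain ⟨φ, hφ, h1, -⟩ := sweep N
  refine ⟨φ, hφ, fun y hy => h1 y hy ?_⟩
  have := hR hy
  rw [Metric.mem_closedBall, dist_zero_right, Real.norm_eq_abs, abs_le] at this
  rw [div_le_iff₀ (by positivity)] at hN
  linarith

/-! ### Functions on plane compacta are rational up to exponentials -/

/-- Every step function is the jump, along the line `re (w z) = c`, of the logarithm of a product of
linear functions: the logarithms of `z - a` chosen on the two sides of a line through `a` agree on
one of the two rays from `a` and differ by `2πi` on the other. -/
lemma exists_jump {K : Set ℂ} {w : ℂ} (hw : w ≠ 0) (c : ℝ) {J : Set ℝ}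
    (hJ : ∀ s ∉ J, w⁻¹ * (c + s * I) ∉ K) {φ : ℝ → ℤ} (hφ : φ ∈ stepGroup J) :
    ∃ v ∈ linearGroup K, ∃ k₁ k₂ : ℂ → ℂ,
      ContinuousOn k₁ (K ∩ {z | (w * z).re ≤ c}) ∧ ContinuousOn k₂ (K ∩ {z | c ≤ (w * z).re}) ∧
      (∀ z ∈ K ∩ {z | (w * z).re ≤ c}, (v z : ℂ) = exp (k₁ z)) ∧
      (∀ z ∈ K ∩ {z | c ≤ (w * z).re}, (v z : ℂ) = exp (k₂ z)) ∧
      ∀ z ∈ K, (w * z).re = c → k₁ z - k₂ z = φ (w * z).im * (2 * Real.pi * I) := by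
  induction hφ using AddSubgroup.closure_induction with
  | mem φ hφ =>
    rcases hφ with ⟨m, rfl⟩ | ⟨s, hs, rfl⟩
    · refine ⟨1, one_mem _, fun _ => m * (2 * Real.pi * I), 0, continuousOn_const,
        continuousOn_const, fun z _ => ?_, fun z _ => by simp, fun z _ _ => by simp⟩
      simp [exp_int_mul_two_pi_mul_I]
    · set a := w⁻¹ * (c + s * I) with ha
      have haK : a ∉ K := hJ s hs
      have hwa : w * a = c + s * I := by rw [ha, mul_inv_cancel_left₀ hw]
      have hsub : ∀ z, w * (z - a) = w * z - (c + s * I) := fun z => by rw [mul_sub, hwa]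
      have hre : ∀ z, (w * (z - a)).re = (w * z).re - c := fun z => by rw [hsub]; simp
      have him : ∀ z, (w * (z - a)).im = (w * z).im - s := fun z => by rw [hsub]; simp
      have hne : ∀ z ∈ K, w * (z - a) ≠ 0 := fun z hz =>
        mul_ne_zero hw (sub_ne_zero.2 (ne_of_mem_of_not_mem hz haK))
      have h1 : ∀ z ∈ K ∩ {z | (w * z).re ≤ c}, -(w * (z - a)) ∈ slitPlane := by
        rintro z ⟨hz, hzc⟩
        rw [mem_slitPlane_iff]
        rcases (show (w * z).re ≤ c from hzc).lt_or_eq with h | h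
        · left; rw [neg_re, hre]; linarith
        · right
          intro h0
          refine hne z hz (Complex.ext (by rw [hre, h]; simp) ?_)
          rwa [neg_im, neg_eq_zero] at h0
      have h2 : ∀ z ∈ K ∩ {z | c ≤ (w * z).re}, w * (z - a) ∈ slitPlane := by
        rintro z ⟨hz, hzc⟩
        rw [mem_slitPlane_iff]
        rcases (show c ≤ (w * z).re from hzc).lt_or_eq with h | h
        · left; rw [hre]; linarith
        · right
          intro h0
          exact hne z hz (Complex.ext (by rw [hre, ← h]; simp) h0)
      have hval : ∀ z ∈ K, ((linearUnit a)⁻¹ z : ℂ)⁻¹ = z - a := fun z hz => by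
        simp [linearUnit_apply (ne_of_mem_of_not_mem hz haK)]
      -- The logarithm of `z - a` jumps by `-2πi` above `a`, hence the inverse; the term `πi` makes
      -- its two branches agree below `a`.
      refine ⟨(linearUnit a)⁻¹, inv_mem (linearUnit_mem_linearGroup haK),
        fun z => -(log (-(w * (z - a))) - Real.pi * I - log w),
        fun z => -(log (w * (z - a)) - log w), ?_, ?_, ?_, ?_, ?_⟩
      · refine (ContinuousOn.sub (ContinuousOn.sub (ContinuousOn.clog ?_ h1) ?_) ?_).neg <;>
          fun_prop
      · refine (ContinuousOn.sub (ContinuousOn.clog ?_ h2) ?_).neg <;> fun_prop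
      · intro z hz
        rw [← inv_inj, hval z hz.1, ← exp_neg, neg_neg, exp_sub, exp_sub,
          exp_log (neg_ne_zero.2 (hne z hz.1)), exp_pi_mul_I, exp_log hw]
        field_simp
      · intro z hz
        rw [← inv_inj, hval z hz.1, ← exp_neg, neg_neg, exp_sub,
          exp_log (hne z hz.1), exp_log hw]
        field_simp
      · intro z hz hzc
        have e : w * (z - a) = ((w * z).im - s : ℝ) * I := by
          apply Complex.ext
          · rw [hre, hzc]; simp
          · rw [him]; simp
        rcases lt_trichotomy s (w * z).im with h | h | h
        · have hpos : 0 < (w * z).im - s := by linarith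
          have e2 : -(((w * z).im - s : ℝ) * I) = ((w * z).im - s : ℝ) * (-I) := by ring
          simp only [e]
          rw [e2, log_ofReal_mul hpos (by simp), log_ofReal_mul hpos I_ne_zero, log_neg_I, log_I]
          simp [indicator, h.le, -mul_im]
          ring
        · exact absurd (by rw [e, ← h]; simp) (hne z hz)
        · have hpos : 0 < s - (w * z).im := by linarith
          have e2 : -(((w * z).im - s : ℝ) * I) = (s - (w * z).im : ℝ) * I := by
            push_cast; ring
          have e3 : (((w * z).im - s : ℝ) * I) = (s - (w * z).im : ℝ) * (-I) := by
            push_cast; ring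
          simp only [e]
          rw [e2, log_ofReal_mul hpos I_ne_zero, e3, log_ofReal_mul hpos (by simp), log_neg_I,
            log_I]
          simp [indicator, not_le.2 h, -mul_im]
          ring
  | zero =>
    exact ⟨1, one_mem _, 0, 0, continuousOn_const, continuousOn_const, by simp, by simp, by simp⟩
  | add φ ψ _ _ hφ hψ =>
    obtain ⟨v, hv, k₁, k₂, a1, a2, a3, a4, a5⟩ := hφ
    obtain ⟨v', hv', k₁', k₂', b1, b2, b3, b4, b5⟩ := hψ
    refine ⟨v * v', mul_mem hv hv', k₁ + k₁', k₂ + k₂', a1.add b1, a2.add b2, fun z hz => ?_,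
      fun z hz => ?_, fun z hz hz' => ?_⟩
    · simp [a3 z hz, b3 z hz, exp_add]
    · simp [a4 z hz, b4 z hz, exp_add]
    · have h1 := a5 z hz hz'
      have h2 := b5 z hz hz'
      simp only [Pi.add_apply]
      push_cast
      linear_combination h1 + h2
  | neg φ _ hφ =>
    obtain ⟨v, hv, k₁, k₂, a1, a2, a3, a4, a5⟩ := hφ
    refine ⟨v⁻¹, inv_mem hv, -k₁, -k₂, a1.neg, a2.neg, fun z hz => ?_,
      fun z hz => ?_, fun z hz hz' => ?_⟩
    · simp [a3 z hz, exp_neg]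
    · simp [a4 z hz, exp_neg]
    · have h1 := a5 z hz hz'
      simp only [Pi.neg_apply]
      push_cast
      linear_combination -h1

/-- A function with logarithms on the two parts into which a line cuts `K` is, on `K`, the product
of a function with a logarithm and of linear functions. -/
lemma mem_sup_of_mem_logOn_halves {K : Set ℂ} (hK : IsCompact K) {w : ℂ} (hw : w ≠ 0) (c : ℝ)
    {u : ℂ → ℂˣ} (h1 : u ∈ logOn (K ∩ {z | (w * z).re ≤ c}))
    (h2 : u ∈ logOn (K ∩ {z | c ≤ (w * z).re})) : u ∈ logOn K ⊔ linearGroup K := by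
  obtain ⟨g₁, hg₁, hu₁⟩ := h1
  obtain ⟨g₂, hg₂, hu₂⟩ := h2
  have hcont : Continuous fun z : ℂ => (w * z).re := by fun_prop
  have hcl : IsClosed {z : ℂ | (w * z).re = c} := isClosed_eq hcont continuous_const
  set L := K ∩ {z | (w * z).re = c} with hL
  have hLc : IsCompact L := hK.inter_right hcl
  set J : Set ℝ := (fun z => (w * z).im) '' L with hJ
  have hJc : IsCompact J := hLc.image (by fun_prop)
  have hback : ∀ z ∈ L, w⁻¹ * (c + ((w * z).im : ℝ) * I) = z := by
    rintro z ⟨_, hz⟩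
    have hz' : (w * z).re = c := hz
    rw [← hz', re_add_im, inv_mul_cancel_left₀ hw]
  have hfor : ∀ s : ℝ, (w * (w⁻¹ * (c + s * I))) = c + s * I := fun s => by
    rw [mul_inv_cancel_left₀ hw]
  have hmem : ∀ s : ℝ, s ∈ J ↔ w⁻¹ * (c + s * I) ∈ K := by
    intro s
    constructor
    · rintro ⟨z, hz, rfl⟩
      rw [hback z hz]; exact hz.1
    · intro h
      exact ⟨_, ⟨h, by rw [mem_ofPred_eq, hfor]; simp⟩, by simp only [hfor]; simp⟩
  have hint : ∀ z ∈ L, ∃ m : ℤ, g₁ z - g₂ z = m * (2 * Real.pi * I) := by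
    rintro z ⟨hz, hz'⟩
    have := (hu₁ z ⟨hz, le_of_eq hz'⟩).symm.trans (hu₂ z ⟨hz, ge_of_eq hz'⟩)
    obtain ⟨m, hm⟩ := exp_eq_exp_iff_exists_int.1 this
    exact ⟨m, by rw [hm]; ring⟩
  choose! m hm using hint
  have hd : ContinuousOn (fun y : ℝ => (m (w⁻¹ * (c + y * I)) : ℝ)) J := by
    have hmaps : MapsTo (fun y : ℝ => w⁻¹ * (c + y * I)) J L := fun y hy =>
      ⟨(hmem y).1 hy, by rw [mem_ofPred_eq, hfor]; simp⟩
    have hc : ContinuousOn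
        (fun y : ℝ => ((g₁ (w⁻¹ * (c + y * I)) - g₂ (w⁻¹ * (c + y * I))) / (2 * Real.pi * I)).re)
        J := by
      have hp : ContinuousOn (fun y : ℝ => w⁻¹ * (c + y * I)) J := by fun_prop
      have q1 := hg₁.comp hp fun y hy => ⟨(hmaps hy).1, le_of_eq (hmaps hy).2⟩
      have q2 := hg₂.comp hp fun y hy => ⟨(hmaps hy).1, ge_of_eq (hmaps hy).2⟩
      exact continuous_re.comp_continuousOn ((q1.sub q2).div_const _)
    refine hc.congr fun y hy => ?_
    have h0 : (2 * Real.pi * I : ℂ) ≠ 0 := two_pi_I_ne_zero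
    simp only [hm _ (hmaps hy)]
    rw [mul_div_cancel_right₀ _ h0, intCast_re]
  obtain ⟨φ, hφ, hφd⟩ := exists_mem_stepGroup hJc hd
  obtain ⟨v, hv, k₁, k₂, a1, a2, a3, a4, a5⟩ :=
    exists_jump (K := K) hw c (fun s hs h => hs ((hmem s).2 h)) hφ
  refine Subgroup.mem_sup.2 ⟨u / v, ?_, v, hv, div_mul_cancel _ _⟩
  classical
  refine ⟨fun z => if (w * z).re ≤ c then g₁ z - k₁ z else g₂ z - k₂ z, ?_, ?_⟩
  · have hcl1 : closure {z : ℂ | (w * z).re ≤ c} ⊆ {z | (w * z).re ≤ c} :=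
      (isClosed_le hcont continuous_const).closure_subset
    have hcl2 : closure {z : ℂ | ¬ (w * z).re ≤ c} ⊆ {z | c ≤ (w * z).re} :=
      closure_minimal (fun z hz => (not_le.1 hz).le) (isClosed_le continuous_const hcont)
    refine ContinuousOn.if ?_ ((hg₁.sub a1).mono (inter_subset_inter_right _ hcl1))
      ((hg₂.sub a2).mono (inter_subset_inter_right _ hcl2))
    rintro z ⟨hz, hzf⟩
    have hzc : (w * z).re = c := by
      have := frontier_le_subset_eq hcont continuous_const hzf
      exact this
    have e1 := a5 z hz hzc
    have e2 := hm z ⟨hz, hzc⟩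
    have e3 := hφd (x := (w * z).im) ⟨z, ⟨hz, hzc⟩, rfl⟩
    simp only [hback z ⟨hz, hzc⟩] at e3
    rw [e3] at e1
    linear_combination e2 - e1
  · intro z hz
    by_cases h : (w * z).re ≤ c
    · simp [-mul_re, h, hu₁ z ⟨hz, h⟩, a3 z ⟨hz, h⟩, exp_sub]
    · have h' : c ≤ (w * z).re := (not_le.1 h).le
      simp [-mul_re, h, hu₂ z ⟨hz, h'⟩, a4 z ⟨hz, h'⟩, exp_sub]

/-- The decomposition into a function with a logarithm and linear functions passes from the two
parts into which a line cuts `K` to `K` itself. -/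
lemma mem_sup_of_halves {K : Set ℂ} (hK : IsCompact K) {w : ℂ} (hw : w ≠ 0) (c : ℝ)
    {u : ℂ → ℂˣ}
    (h1 : u ∈ logOn (K ∩ {z | (w * z).re ≤ c}) ⊔ linearGroup (K ∩ {z | (w * z).re ≤ c}))
    (h2 : u ∈ logOn (K ∩ {z | c ≤ (w * z).re}) ⊔ linearGroup (K ∩ {z | c ≤ (w * z).re})) :
    u ∈ logOn K ⊔ linearGroup K := by
  -- On each part only the factors `z - a` with `a` strictly on its side are needed, and these have
  -- logarithms on the other part. Divided by the factors from both sides, `u` has a logarithm on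
  -- either part.
  set K₁ := K ∩ {z | (w * z).re ≤ c}
  set K₂ := K ∩ {z | c ≤ (w * z).re}
  set Z₁ := Subgroup.closure (linearUnit '' {a | a ∉ K ∧ (w * a).re < c})
  set Z₂ := Subgroup.closure (linearUnit '' {a | a ∉ K ∧ c < (w * a).re})
  have q1 : linearGroup K₁ ≤ logOn K₁ ⊔ Z₁ := by
    rw [linearGroup, Subgroup.closure_le]
    rintro _ ⟨a, ha, rfl⟩
    rcases lt_or_ge (w * a).re c with h | h
    · exact Subgroup.mem_sup_right (Subgroup.subset_closure
        ⟨a, ⟨fun haK => ha ⟨haK, h.le⟩, h⟩, rfl⟩)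
    · refine Subgroup.mem_sup_left (linearUnit_mem_logOn_of_halfPlane (w := -w) ha
        (fun z hz => ?_) (neg_ne_zero.2 hw))
      have : (w * z).re ≤ c := hz.2
      rw [neg_mul, neg_re, mul_sub, sub_re]; linarith
  have q2 : linearGroup K₂ ≤ logOn K₂ ⊔ Z₂ := by
    rw [linearGroup, Subgroup.closure_le]
    rintro _ ⟨a, ha, rfl⟩
    rcases lt_or_ge c (w * a).re with h | h
    · exact Subgroup.mem_sup_right (Subgroup.subset_closure
        ⟨a, ⟨fun haK => ha ⟨haK, h.le⟩, h⟩, rfl⟩)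
    · refine Subgroup.mem_sup_left (linearUnit_mem_logOn_of_halfPlane (w := w) ha
        (fun z hz => ?_) hw)
      have : c ≤ (w * z).re := hz.2
      rw [mul_sub, sub_re]; linarith
  have r1 : Z₁ ≤ logOn K₂ := by
    rw [Subgroup.closure_le]
    rintro _ ⟨a, ⟨ha, hac⟩, rfl⟩
    refine linearUnit_mem_logOn_of_halfPlane (w := w) (fun h => ha h.1) (fun z hz => ?_) hw
    have : c ≤ (w * z).re := hz.2
    rw [mul_sub, sub_re]; linarith
  have r2 : Z₂ ≤ logOn K₁ := by
    rw [Subgroup.closure_le]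
    rintro _ ⟨a, ⟨ha, hac⟩, rfl⟩
    refine linearUnit_mem_logOn_of_halfPlane (w := -w) (fun h => ha h.1) (fun z hz => ?_)
      (neg_ne_zero.2 hw)
    have : (w * z).re ≤ c := hz.2
    rw [neg_mul, neg_re, mul_sub, sub_re]; linarith
  have s1 : Z₁ ≤ linearGroup K := Subgroup.closure_mono (image_mono fun a ha => ha.1)
  have s2 : Z₂ ≤ linearGroup K := Subgroup.closure_mono (image_mono fun a ha => ha.1)
  obtain ⟨l₁, hl₁, z₁, hz₁, e₁⟩ := Subgroup.mem_sup.1 ((sup_le le_sup_left q1 :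
    logOn K₁ ⊔ linearGroup K₁ ≤ _) h1)
  obtain ⟨l₂, hl₂, z₂, hz₂, e₂⟩ := Subgroup.mem_sup.1 ((sup_le le_sup_left q2 :
    logOn K₂ ⊔ linearGroup K₂ ≤ _) h2)
  have t1 : u / (z₁ * z₂) ∈ logOn K₁ := by
    have : u / (z₁ * z₂) = l₁ / z₂ := by rw [← e₁, mul_comm z₁ z₂, mul_div_mul_right_eq_div]
    rw [this]; exact div_mem hl₁ (r2 hz₂)
  have t2 : u / (z₁ * z₂) ∈ logOn K₂ := by
    have : u / (z₁ * z₂) = l₂ / z₁ := by rw [← e₂, mul_div_mul_right_eq_div]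
    rw [this]; exact div_mem hl₂ (r1 hz₁)
  have := mul_mem (mem_sup_of_mem_logOn_halves hK hw c t1 t2)
    (Subgroup.mem_sup_right (mul_mem (s1 hz₁) (s2 hz₂)) : z₁ * z₂ ∈ logOn K ⊔ linearGroup K)
  rwa [div_mul_cancel] at this

/-- A property of compact sets that passes from the two parts into which any line of a given
direction cuts a set to the set holds for `K` as soon as it holds for the parts of `K` in thin
strips. -/
lemma sweep {Q : Set ℂ → Prop} {w : ℂ} (h0 : Q ∅)
    (hglue : ∀ K, IsCompact K → ∀ c : ℝ, Q (K ∩ {z | (w * z).re ≤ c}) →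
      Q (K ∩ {z | c ≤ (w * z).re}) → Q K)
    {η : ℝ} (hη : 0 < η) {K : Set ℂ} (hK : IsCompact K)
    (hthin : ∀ c : ℝ, Q (K ∩ {z | c ≤ (w * z).re ∧ (w * z).re ≤ c + η})) : Q K := by
  have hcont : Continuous fun z : ℂ => (w * z).re := by fun_prop
  obtain ⟨R, hR⟩ := (hK.image hcont).isBounded.subset_closedBall 0
  have hR' : ∀ z ∈ K, -R ≤ (w * z).re ∧ (w * z).re ≤ R := by
    intro z hz
    have := hR ⟨z, hz, rfl⟩
    rwa [Metric.mem_closedBall, dist_zero_right, Real.norm_eq_abs, abs_le] at this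
  have step : ∀ N : ℕ, Q (K ∩ {z | (w * z).re ≤ -R - 1 + N * η}) := by
    intro N
    induction N with
    | zero =>
      have : K ∩ {z | (w * z).re ≤ -R - 1 + (0 : ℕ) * η} = ∅ := by
        ext z
        simp only [mem_inter_iff, mem_ofPred_eq, mem_empty_iff_false, iff_false, not_and]
        intro hz
        have := hR' z hz
        push_cast
        linarith
      rw [this]; exact h0
    | succ N ih =>
      refine hglue _ (hK.inter_right (isClosed_le hcont continuous_const)) (-R - 1 + N * η) ?_ ?_
      · convert ih using 1
        ext z
        simp only [mem_inter_iff, mem_ofPred_eq]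
        push_cast
        constructor
        · rintro ⟨⟨a, b⟩, c⟩; exact ⟨a, c⟩
        · rintro ⟨a, c⟩; exact ⟨⟨a, by linarith⟩, c⟩
      · convert hthin (-R - 1 + N * η) using 1
        ext z
        simp only [mem_inter_iff, mem_ofPred_eq]
        push_cast
        constructor
        · rintro ⟨⟨a, b⟩, c⟩; exact ⟨a, c, by linarith⟩
        · rintro ⟨a, b, c⟩; exact ⟨⟨a, by linarith⟩, b⟩
  obtain ⟨N, hN⟩ := exists_nat_ge ((2 * R + 1) / η)
  rw [div_le_iff₀ hη] at hN
  convert step N using 1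
  ext z
  simp only [mem_inter_iff, mem_ofPred_eq]
  exact ⟨fun hz => ⟨hz, by linarith [(hR' z hz).2]⟩, fun hz => hz.1⟩

/-- Eilenberg's theorem: a nonvanishing continuous function on a plane compact set `K` is the
product of an exponential and of integer powers of linear functions `z - a` with `a ∉ K`. -/
theorem mem_logOn_sup_linearGroup {K : Set ℂ} (hK : IsCompact K) {u : ℂ → ℂˣ}
    (hu : ContinuousOn (fun z => (u z : ℂ)) K) : u ∈ logOn K ⊔ linearGroup K := by
  obtain ⟨ε, hε, hεu⟩ : ∃ ε > 0, ∀ z ∈ K, ε ≤ ‖(u z : ℂ)‖ := by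
    rcases K.eq_empty_or_nonempty with rfl | hne
    · exact ⟨1, one_pos, by simp⟩
    · obtain ⟨z, hz, hmin⟩ := hK.exists_isMinOn hne hu.norm
      exact ⟨‖(u z : ℂ)‖, by simp, fun y hy => hmin hy⟩
  have huc := hK.uniformContinuousOn_of_continuous hu
  rw [Metric.uniformContinuousOn_iff] at huc
  obtain ⟨δ, hδ, hδ'⟩ := huc ε hε
  have small : ∀ T ⊆ K, (∀ x ∈ T, ∀ y ∈ T, dist x y < δ) → u ∈ logOn T := by
    intro T hT hd
    rcases T.eq_empty_or_nonempty with rfl | ⟨x, hx⟩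
    · exact ⟨0, continuousOn_const, by simp⟩
    · refine mem_logOn_of_slitPlane (hu.mono hT) (w := (u x : ℂ)⁻¹) (by simp) fun z hz => ?_
      have h1 := hδ' z (hT hz) x (hT hx) (hd z hz x hx)
      have h2 := hεu x (hT hx)
      have h3 : ‖(u x : ℂ)⁻¹ * u z - 1‖ < 1 := by
        have : (u x : ℂ)⁻¹ * u z - 1 = (u x : ℂ)⁻¹ * (u z - u x) := by
          rw [mul_sub]; simp
        rw [this, norm_mul, norm_inv, ← dist_eq_norm,
          inv_mul_lt_iff₀ (by simp), mul_one]
        linarith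
      refine mem_slitPlane_iff.2 (Or.inl ?_)
      have h4 := (abs_le.1 (abs_re_le_norm ((u x : ℂ)⁻¹ * u z - 1))).1
      rw [sub_re, one_re] at h4
      linarith
  have h0 : u ∈ logOn ∅ ⊔ linearGroup ∅ :=
    Subgroup.mem_sup_left ⟨0, continuousOn_const, by simp⟩
  have hc1 : Continuous fun z : ℂ => (1 * z).re := by fun_prop
  refine sweep (w := 1) (η := δ / 3) (Q := fun T => u ∈ logOn T ⊔ linearGroup T) h0
    (fun T hT c => mem_sup_of_halves hT one_ne_zero c) (by positivity) hK fun c => ?_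
  refine sweep (w := I) (η := δ / 3) (Q := fun T => u ∈ logOn T ⊔ linearGroup T) h0
    (fun T hT c => mem_sup_of_halves hT I_ne_zero c) (by positivity)
    (hK.inter_right ((isClosed_le continuous_const hc1).inter
      (isClosed_le hc1 continuous_const))) fun c' => ?_
  refine Subgroup.mem_sup_left (small _ (fun z hz => hz.1.1) ?_)
  rintro x ⟨⟨-, hx1, hx2⟩, hx3, hx4⟩ y ⟨⟨-, hy1, hy2⟩, hy3, hy4⟩
  simp only [one_mul, I_mul_re] at *
  have := norm_le_abs_re_add_abs_im (x - y)
  rw [dist_eq_norm]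
  have e1 : |(x - y).re| ≤ δ / 3 := by rw [sub_re, abs_le]; constructor <;> linarith
  have e2 : |(x - y).im| ≤ δ / 3 := by rw [sub_im, abs_le]; constructor <;> linarith
  linarith

end PlaneLog

namespace PlaneLog

open Complex Set Metric

/-! ### Winding numbers -/

lemma continuousOn_of_mem_linearGroup {K : Set ℂ} {u : ℂ → ℂˣ} (hu : u ∈ linearGroup K) :
    ContinuousOn (fun z => (u z : ℂ)) K := by
  induction hu using Subgroup.closure_induction with
  | mem u hu =>
    obtain ⟨a, ha, rfl⟩ := hu
    exact continuousOn_linearUnit ha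
  | one => simpa using continuousOn_const
  | mul u v _ _ hu hv => simpa [Pi.mul_def] using hu.mul hv
  | inv u _ hu => simpa [Pi.inv_def] using hu.inv₀ fun z _ => (u z).ne_zero

lemma linearUnit_mem_logOn_closedBall {a : ℂ} (ha : 1 < ‖a‖) :
    linearUnit a ∈ logOn (closedBall 0 1) := by
  refine linearUnit_mem_logOn_of_halfPlane (w := -(starRingEnd ℂ) a) (by simpa using ha)
    (fun z hz => ?_) ?_
  · have h1 : ((starRingEnd ℂ) a * z).re ≤ ‖a‖ * ‖z‖ := by
      simpa using re_le_norm ((starRingEnd ℂ) a * z)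
    have h2 : ((starRingEnd ℂ) a * a).re = ‖a‖ * ‖a‖ := by
      rw [mul_comm, mul_conj, normSq_eq_norm_sq, ofReal_re, sq]
    have h3 : ‖z‖ ≤ 1 := by simpa using hz
    rw [neg_mul, neg_re, mul_sub, sub_re, h2]
    nlinarith
  · intro h
    have : a = 0 := by simpa using h
    norm_num [this] at ha

/-- Nonvanishing continuous functions on the closed unit disk have logarithms. -/
lemma mem_logOn_closedBall {u : ℂ → ℂˣ}
    (hu : ContinuousOn (fun z => (u z : ℂ)) (closedBall 0 1)) : u ∈ logOn (closedBall 0 1) := by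
  have h := mem_logOn_sup_linearGroup (isCompact_closedBall 0 1) hu
  have h2 : linearGroup (closedBall 0 1) ≤ logOn (closedBall 0 1) := by
    rw [linearGroup, Subgroup.closure_le]
    rintro _ ⟨a, ha, rfl⟩
    exact linearUnit_mem_logOn_closedBall (by simpa using ha)
  exact (sup_le le_rfl h2 : logOn (closedBall 0 1) ⊔ _ ≤ _) h

/-- Within a connected set off `K`, moving `a` changes `z - a` on `K` by an exponential only. -/
lemma linearUnit_div_mem_logOn {K S : Set ℂ} (hK : IsClosed K) (hS : IsPreconnected S)
    (hKS : S ⊆ Kᶜ) {a b : ℂ} (ha : a ∈ S) (hb : b ∈ S) :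
    linearUnit a / linearUnit b ∈ logOn K := by
  refine hS.induction₂ (fun a b => linearUnit a / linearUnit b ∈ logOn K) ?_ ?_ ?_ ha hb
  · intro x hx
    obtain ⟨ε, hε, hball⟩ := Metric.isOpen_iff.1 hK.isOpen_compl x (hKS hx)
    filter_upwards [inter_mem_nhdsWithin S (Metric.ball_mem_nhds x hε)] with y hy
    have hyK := hKS hy.1
    refine inv_mem_iff.1 ?_
    refine mem_logOn_of_slitPlane (w := 1) ?_ one_ne_zero fun z hz => ?_
    · have := (continuousOn_linearUnit hyK).div (continuousOn_linearUnit (hKS hx))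
        fun z _ => (linearUnit x z).ne_zero
      simpa [Pi.div_def] using this
    · have hzx : z ≠ x := ne_of_mem_of_not_mem hz (hKS hx)
      have hzy : z ≠ y := ne_of_mem_of_not_mem hz hyK
      have hd : ε ≤ ‖z - x‖ := by
        by_contra h
        exact hball (by rw [mem_ball, dist_eq_norm]; exact not_le.1 h) hz
      have hyx : ‖x - y‖ < ε := by
        have := hy.2; rwa [mem_ball, dist_comm, dist_eq_norm] at this
      have e : (1 : ℂ) * ((linearUnit x / linearUnit y)⁻¹ z : ℂˣ) = 1 + (x - y) / (z - x) := by
        have h0 := sub_ne_zero.2 hzx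
        simp [linearUnit_apply hzx, linearUnit_apply hzy]
        field_simp
        ring
      rw [e]
      have h1 : ‖(x - y) / (z - x)‖ < 1 := by
        rw [norm_div, div_lt_one (norm_pos_iff.2 (sub_ne_zero.2 hzx))]; linarith
      refine mem_slitPlane_iff.2 (Or.inl ?_)
      have := (abs_le.1 (abs_re_le_norm ((x - y) / (z - x)))).1
      rw [add_re, one_re]; linarith
  · intro x y z _ _ _ h1 h2
    have := mul_mem h1 h2
    rwa [div_mul_div_cancel] at this
  · intro x y _ _ h
    have := inv_mem h
    rwa [inv_div] at this

/-- Two logarithms of one function on a connected set differ by a constant multiple of `2πi`. -/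
lemma exists_int_of_exp_eq {α : Type*} [TopologicalSpace α] {S : Set α} (hS : IsPreconnected S)
    {f g : α → ℂ} (hf : ContinuousOn f S) (hg : ContinuousOn g S)
    (h : ∀ x ∈ S, exp (f x) = exp (g x)) :
    ∃ k : ℤ, ∀ x ∈ S, f x = g x + k * (2 * Real.pi * I) := by
  choose! m hm using fun x hx => exp_eq_exp_iff_exists_int.1 (h x hx)
  have hmc : ContinuousOn m S := by
    rw [Int.isClosedEmbedding_coe_real.isInducing.continuousOn_iff]
    have : ContinuousOn (fun x => ((f x - g x) / (2 * Real.pi * I)).re) S :=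
      continuous_re.comp_continuousOn ((hf.sub hg).div_const _)
    refine this.congr fun x hx => ?_
    simp only [Function.comp_apply]
    rw [hm x hx, add_sub_cancel_left, mul_div_cancel_right₀ _ two_pi_I_ne_zero, intCast_re]
  rcases S.eq_empty_or_nonempty with rfl | ⟨x, hx⟩
  · exact ⟨0, by simp⟩
  · exact ⟨m x, fun y hy => by rw [hm y hy, hS.constant hmc hx hy]⟩

/-- The function `z ^ n` has no logarithm on the unit circle, unless `n = 0`. -/
lemma eq_zero_of_zpow_mem_logOn_sphere {n : ℤ} (h : linearUnit 0 ^ n ∈ logOn (sphere 0 1)) :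
    n = 0 := by
  obtain ⟨g, hg, hu⟩ := h
  have hmem : ∀ θ : ℝ, exp (θ * I) ∈ sphere (0 : ℂ) 1 := fun θ => by
    simp [norm_exp_ofReal_mul_I]
  have hc : Continuous fun θ : ℝ => g (exp (θ * I)) := by
    rw [← continuousOn_univ]
    exact hg.comp (by fun_prop) fun θ _ => hmem θ
  have hc2 : Continuous fun θ : ℝ => n * (θ * I) := by fun_prop
  obtain ⟨k, hk⟩ := exists_int_of_exp_eq (isPreconnected_univ (α := ℝ)) hc.continuousOn
    hc2.continuousOn fun θ _ => by
      rw [← hu _ (hmem θ), exp_int_mul]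
      simp [linearUnit_apply (exp_ne_zero _)]
  have h0 := hk 0 trivial
  have h1 := hk (2 * Real.pi) trivial
  have e : exp ((2 * Real.pi : ℝ) * I) = exp ((0 : ℝ) * I) := by
    push_cast; rw [exp_two_pi_mul_I]; simp
  rw [e, h0] at h1
  have h2 : (n : ℂ) * (2 * Real.pi * I) = 0 := by
    push_cast at h1
    linear_combination -h1
  simpa using (mul_eq_zero.1 h2).resolve_right two_pi_I_ne_zero

lemma linearUnit_div_mem_logOn_sphere {a : ℂ} (ha : a ∈ ball (0 : ℂ) 1) :
    linearUnit a / linearUnit 0 ∈ logOn (sphere 0 1) :=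
  linearUnit_div_mem_logOn isClosed_sphere (convex_ball 0 1).isPreconnected
    (fun z hz hz' => by simp_all) ha (by simp)

/-! ### Complementary components of a compact set in the disk -/

variable {X : Set ℂ}

lemma closure_component_inter {a b : ℂ} (hX : IsClosed X) (hb : b ∈ ball 0 1 \ X)
    (h : b ∈ closure (connectedComponentIn (ball 0 1 \ X) a)) :
    b ∈ connectedComponentIn (ball 0 1 \ X) a := by
  have ho : IsOpen (ball (0 : ℂ) 1 \ X) := isOpen_ball.sdiff hX
  obtain ⟨z, hz1, hz2⟩ := mem_closure_iff.1 h _ ho.connectedComponentIn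
    (mem_connectedComponentIn hb)
  have := (connectedComponentIn_eq hz1).trans (connectedComponentIn_eq hz2).symm
  rw [← this]
  exact mem_connectedComponentIn hb

/-- The winding number around `a` of a function with a logarithm on `X` vanishes: if `(z - a) ^ n`
times a function without zeros or poles on the component of `a` in the complement of `X` has a
logarithm on `X`, then it can be replaced on this component by an exponential, so that `(z - a) ^ n`
extends from the unit circle to the disk without zeros. -/
lemma eq_zero_of_mul_mem_logOn (hX : IsClosed X) (hS : sphere 0 1 ⊆ X) {a : ℂ}
    (ha : a ∈ ball 0 1 \ X) {n : ℤ} {r : ℂ → ℂˣ}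
    (hr : r ∈ linearGroup (closure (connectedComponentIn (ball 0 1 \ X) a)))
    (h : linearUnit a ^ n * r ∈ logOn X) : n = 0 := by
  classical
  obtain ⟨g, hg, hu⟩ := h
  set U := connectedComponentIn (ball 0 1 \ X) a with hU
  have hUo : IsOpen U := (isOpen_ball.sdiff hX).connectedComponentIn
  have hUΩ : U ⊆ ball 0 1 \ X := connectedComponentIn_subset _ _
  have haU : a ∈ U := mem_connectedComponentIn ha
  have hfr : frontier U ⊆ X := by
    intro z hz
    by_contra hzX
    have hzb : z ∈ closedBall (0 : ℂ) 1 :=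
      closure_minimal ((hUΩ.trans sdiff_subset).trans ball_subset_closedBall) isClosed_closedBall
        (frontier_subset_closure hz)
    have hzb' : z ∈ ball (0 : ℂ) 1 := by
      rw [← ball_union_sphere] at hzb
      exact hzb.resolve_right fun h => hzX (hS h)
    have := closure_component_inter hX ⟨hzb', hzX⟩ (frontier_subset_closure hz)
    rw [frontier, hUo.interior_eq] at hz
    exact hz.2 this
  obtain ⟨G, hG⟩ := ContinuousMap.exists_restrict_eq hX ⟨X.domRestrict g, hg.domRestrict⟩
  have hGg : ∀ z ∈ X, G z = g z := fun z hz => 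
    congrArg (fun f : C(X, ℂ) => f ⟨z, hz⟩) hG
  set H : ℂ → ℂˣ := fun z => if z ∈ U then Units.mk0 (exp (G z)) (exp_ne_zero _) * (r z)⁻¹ else
    linearUnit a z ^ n with hH
  have hHc : Continuous fun z => (H z : ℂ) := by
    have e : (fun z => (H z : ℂ)) = fun z => if z ∈ U then exp (G z) * ((r z : ℂ))⁻¹ else
        (linearUnit a z : ℂ) ^ n := by
      ext z
      simp only [hH]
      split_ifs <;> simp
    rw [e]
    refine continuous_if (fun z hz => ?_) ?_ ?_
    · have hzX := hfr hz
      have := hu z hzX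
      rw [hGg z hzX, ← this]
      simp
    · refine (ContinuousOn.mul (by fun_prop) ?_)
      exact (continuousOn_of_mem_linearGroup hr).inv₀ fun z _ => (r z).ne_zero
    · have : IsClosed {z | ¬ z ∈ U} := hUo.isClosed_compl
      rw [this.closure_eq]
      exact (continuousOn_linearUnit (S := {z | z ∉ U}) (fun h => h haU)).zpow₀ n
        fun z _ => Or.inl (linearUnit a z).ne_zero
  have h1 : H ∈ logOn (sphere 0 1) :=
    logOn_anti sphere_subset_closedBall (mem_logOn_closedBall hHc.continuousOn)
  have h2 : linearUnit a ^ n ∈ logOn (sphere 0 1) := by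
    refine mem_logOn_congr (fun z hz => ?_) h1
    have : z ∉ U := fun h => (hUΩ h).2 (hS hz)
    simp [hH, this]
  have h3 := zpow_mem (linearUnit_div_mem_logOn_sphere ha.1) n
  refine eq_zero_of_zpow_mem_logOn_sphere ?_
  have := div_mem h2 h3
  rwa [div_zpow, div_div_cancel] at this

/-- Up to exponentials, the nonvanishing continuous functions on `X` are generated by functions
`z - a`, with one `a` in each component of the complement of `X` in the disk. -/
lemma mem_logOn_sup_closure (hX : IsCompact X) (hX1 : X ⊆ closedBall 0 1) {ι : Type*}
    {a : ι → ℂ} (ha : ∀ b ∈ ball 0 1 \ X, ∃ i, a i ∈ connectedComponentIn (ball 0 1 \ X) b)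
    (hS : sphere 0 1 ⊆ X)
    {u : ℂ → ℂˣ} (hu : ContinuousOn (fun z => (u z : ℂ)) X) :
    u ∈ logOn X ⊔ Subgroup.closure (range fun i => linearUnit (a i)) := by
  refine (sup_le le_sup_left ?_ : logOn X ⊔ linearGroup X ≤ _) (mem_logOn_sup_linearGroup hX hu)
  rw [linearGroup, Subgroup.closure_le]
  rintro _ ⟨b, hb, rfl⟩
  by_cases hb1 : b ∈ closedBall (0 : ℂ) 1
  · have hb' : b ∈ ball 0 1 \ X := by
      rw [← ball_union_sphere] at hb1
      exact ⟨hb1.resolve_right fun h => hb (hS h), hb⟩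
    obtain ⟨i, hi⟩ := ha b hb'
    have h1 := linearUnit_div_mem_logOn hX.isClosed isPreconnected_connectedComponentIn
      (fun z hz => (connectedComponentIn_subset _ _ hz).2) (mem_connectedComponentIn hb') hi
    exact Subgroup.mem_sup.2 ⟨_, h1, _, Subgroup.subset_closure ⟨i, rfl⟩, div_mul_cancel _ _⟩
  · exact Subgroup.mem_sup_left (logOn_anti hX1 (linearUnit_mem_logOn_closedBall
      (by simpa using hb1)))

end PlaneLog

namespace PlaneBipartiteGraph

open PlaneLog Complex Set Metric

variable {n : ℕ} {V E : Type*} (G : PlaneBipartiteGraph n V E)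

/-! ### Endpoints and arcs of a plane-bipartite graph -/

lemma norm_point_inr (i : Fin n) : ‖G.point (Sum.inr i)‖ = 1 := norm_exp_ofReal_mul_I _

lemma point_injective : Function.Injective G.point := by
  have hb : ∀ i j : Fin n, i < j → G.point (Sum.inr i) ≠ G.point (Sum.inr j) := by
    intro i j hij h
    obtain ⟨k, hk⟩ := exp_eq_exp_iff_exists_int.1
      (show exp (G.angle i * I) = exp (G.angle j * I) from h)
    have hk' : (G.angle i : ℂ) = G.angle j + k * (2 * Real.pi) := by
      apply mul_right_cancel₀ I_ne_zero
      rw [hk]; ring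
    have hk2 : G.angle i = G.angle j + k * (2 * Real.pi) := by exact_mod_cast hk'
    have h1 := G.angle_strictAnti hij
    have h2 := G.angle_lt i j
    have hpi := Real.pi_pos
    have h3 : (0 : ℝ) < k := by
      by_contra h0
      nlinarith [not_lt.1 h0]
    have h4 : (k : ℝ) < 1 := by
      by_contra h0
      nlinarith [not_lt.1 h0]
    have h5 : 0 < k := by exact_mod_cast h3
    have h6 : k < 1 := by exact_mod_cast h4
    omega
  rintro (u | i) (v | j) h
  · rw [G.pos_injective h]
  · have h1 := G.norm_pos_lt u
    have h2 := G.norm_point_inr j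
    rw [← h] at h2
    exact absurd h2 h1.ne
  · have h1 := G.norm_pos_lt v
    have h2 := G.norm_point_inr i
    rw [h] at h2
    exact absurd h2 h1.ne
  · rcases lt_trichotomy i j with hij | rfl | hij
    · exact absurd h (hb i j hij)
    · rfl
    · exact absurd h.symm (hb j i hij)

lemma exists_ends (e : E) : ∃ p : (V ⊕ Fin n) × (V ⊕ Fin n), G.ends e = s(p.1, p.2) ∧
    G.curve e 0 = G.point p.1 ∧ G.curve e 1 = G.point p.2 := by
  have h := G.curve_ends e
  generalize G.ends e = q at h ⊢
  induction q with
  | h a b =>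
    rw [Sym2.map_mk, Sym2.eq_iff] at h
    rcases h with ⟨h1, h2⟩ | ⟨h1, h2⟩
    · exact ⟨(a, b), rfl, h1, h2⟩
    · exact ⟨(b, a), Sym2.eq_swap, h1, h2⟩

/-- The starting vertex of an edge, in the direction of its parametrization. -/
noncomputable def src (e : E) : V ⊕ Fin n := (G.exists_ends e).choose.1

/-- The final vertex of an edge, in the direction of its parametrization. -/
noncomputable def tgt (e : E) : V ⊕ Fin n := (G.exists_ends e).choose.2

lemma ends_eq (e : E) : G.ends e = s(G.src e, G.tgt e) := (G.exists_ends e).choose_spec.1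

lemma curve_zero (e : E) : G.curve e 0 = G.point (G.src e) := (G.exists_ends e).choose_spec.2.1

lemma curve_one (e : E) : G.curve e 1 = G.point (G.tgt e) := (G.exists_ends e).choose_spec.2.2

lemma norm_point_le (w : V ⊕ Fin n) : ‖G.point w‖ ≤ 1 := by
  rcases w with v | i
  · exact (G.norm_pos_lt v).le
  · exact (G.norm_point_inr i).le

lemma norm_curve_le (e : E) (t : unitInterval) : ‖G.curve e t‖ ≤ 1 := by
  by_cases h0 : t = 0
  · rw [h0, curve_zero]; exact G.norm_point_le _
  by_cases h1 : t = 1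
  · rw [h1, curve_one]; exact G.norm_point_le _
  exact (G.norm_curve_lt e t h0 h1).le

lemma point_mem_range_curve {e : E} {w : V ⊕ Fin n} (h : w ∈ G.ends e) :
    G.point w ∈ range (G.curve e) := by
  rw [G.ends_eq, Sym2.mem_iff] at h
  rcases h with rfl | rfl
  · exact ⟨0, G.curve_zero e⟩
  · exact ⟨1, G.curve_one e⟩

/-- The drawing of `G` together with the unit circle. -/
def skeleton : Set ℂ := sphere 0 1 ∪ G.support

lemma ball_sdiff_skeleton : ball 0 1 \ G.skeleton = ball 0 1 \ G.support := by
  ext z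
  simp only [skeleton, mem_sdiff, mem_union, mem_ball_zero_iff, mem_sphere_zero_iff_norm, not_or]
  exact ⟨fun h => ⟨h.1, h.2.2⟩, fun h => ⟨h.1, h.1.ne, h.2⟩⟩

lemma skeleton_subset : G.skeleton ⊆ closedBall 0 1 := by
  rintro z (hz | ⟨w, rfl⟩ | hz)
  · exact sphere_subset_closedBall hz
  · simpa using G.norm_point_le w
  · obtain ⟨e, t, rfl⟩ := mem_iUnion.1 hz
    simpa using G.norm_curve_le e t

/-- If each internal vertex lies on an edge, then the vertices need not be listed. -/
lemma skeleton_eq (hV : ∀ v, ∃ e, Sum.inl v ∈ G.ends e) :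
    G.skeleton = sphere 0 1 ∪ ⋃ e, range (G.curve e) := by
  have : range G.point ⊆ ⋃ e, range (G.curve e) := by
    rintro _ ⟨w | i, rfl⟩
    · obtain ⟨e, he⟩ := hV w
      exact mem_iUnion.2 ⟨e, G.point_mem_range_curve he⟩
    · obtain ⟨e, he, -⟩ := G.boundary_single i
      exact mem_iUnion.2 ⟨e, G.point_mem_range_curve he⟩
  rw [skeleton, support, union_eq_self_of_subset_left this]

lemma isCompact_range_curve (e : E) : IsCompact (range (G.curve e)) :=
  isCompact_range (G.curve e).continuous

lemma isCompact_support [Finite V] [Finite E] : IsCompact G.support :=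
  (finite_range _).isCompact.union (isCompact_iUnion G.isCompact_range_curve)

lemma isCompact_skeleton [Finite V] [Finite E] : IsCompact G.skeleton :=
  (isCompact_sphere _ _).union G.isCompact_support

lemma continuousOn_range_curve {e : E} {f : ℂ → ℂ} :
    ContinuousOn f (range (G.curve e)) ↔ Continuous fun t => f (G.curve e t) := by
  have := ((G.curve e).continuous.isClosedEmbedding
    (G.curve_injective e)).isInducing.continuousOn_image_iff (g := f) (s := univ)
  rwa [image_univ, continuousOn_univ] at this

/-- A function on the skeleton is continuous if it is so on the circle and on each arc. -/
lemma continuousOn_skeleton [Finite E] (hV : ∀ v, ∃ e, Sum.inl v ∈ G.ends e) {f : ℂ → ℂ}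
    (h1 : ContinuousOn f (sphere 0 1)) (h2 : ∀ e, Continuous fun t => f (G.curve e t)) :
    ContinuousOn f G.skeleton := by
  rw [G.skeleton_eq hV]
  refine h1.union_of_isClosed ?_ isClosed_sphere
    (isClosed_iUnion_of_finite fun e => (G.isCompact_range_curve e).isClosed)
  exact (locallyFinite_of_finite _).continuousOn_iUnion
    (fun e => (G.isCompact_range_curve e).isClosed) fun e => G.continuousOn_range_curve.2 (h2 e)

lemma curve_mem_skeleton (e : E) (t : unitInterval) : G.curve e t ∈ G.skeleton :=
  Or.inr (Or.inr (mem_iUnion.2 ⟨e, t, rfl⟩))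

lemma point_mem_skeleton (w : V ⊕ Fin n) : G.point w ∈ G.skeleton :=
  Or.inr (Or.inl ⟨w, rfl⟩)

/-! ### The cochain of a nonvanishing function -/

/-- The extension by zero of a function on internal vertices to all vertices. -/
def extendZero {R : Type*} [Zero R] (p : V → R) : V ⊕ Fin n → R := Sum.elim p fun _ => 0

/-- The coboundary map of `G` relative to its boundary vertices, for the orientation of the edges by
their parametrizations. -/
noncomputable def coboundary (R : Type*) [CommRing R] : (V → R) →ₗ[R] (E → R) where
  toFun p e := extendZero p (G.tgt e) - extendZero p (G.src e)
  map_add' p q := by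
    ext e
    have : ∀ w : V ⊕ Fin n, extendZero (p + q) w = extendZero p w + extendZero q w := by
      rintro (v | i) <;> simp [extendZero]
    simp only [this, Pi.add_apply]; ring
  map_smul' r p := by
    ext e
    have : ∀ w : V ⊕ Fin n, extendZero (r • p) w = r * extendZero p w := by
      rintro (v | i) <;> simp [extendZero]
    simp only [this, Pi.smul_apply, smul_eq_mul, RingHom.id_apply]; ring

lemma coboundary_apply {R : Type*} [CommRing R] (p : V → R) (e : E) :
    G.coboundary R p e = extendZero p (G.tgt e) - extendZero p (G.src e) := rfl

/-- The pairs of a nonvanishing function `u` on the skeleton with a logarithm on the unit circle and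
of a cochain that represents its winding: after a choice of logarithms at the vertices, on
the boundary in accordance with a logarithm `g` on the circle, the value of the cochain at an edge
is the number of turns by which the increment of `log u` along the edge differs from the
difference of the chosen values. -/
def windingGroup : Subgroup ((ℂ → ℂˣ) × Multiplicative (E → ℤ)) where
  carrier := {x | ∃ (g : ℂ → ℂ) (l : V ⊕ Fin n → ℂ) (k : E → unitInterval → ℂ),
    ContinuousOn g (sphere 0 1) ∧ (∀ z ∈ sphere 0 1, (x.1 z : ℂ) = exp (g z)) ∧
    (∀ i, l (Sum.inr i) = g (G.point (Sum.inr i))) ∧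
    (∀ w, (x.1 (G.point w) : ℂ) = exp (l w)) ∧
    (∀ e, Continuous (k e)) ∧ (∀ e t, (x.1 (G.curve e t) : ℂ) = exp (k e t)) ∧
    ∀ e, k e 1 - k e 0 = l (G.tgt e) - l (G.src e) + x.2.toAdd e * (2 * Real.pi * I)}
  one_mem' := ⟨0, 0, 0, continuousOn_const, by simp, by simp, by simp,
    fun _ => continuous_const, by simp, by simp⟩
  mul_mem' := by
    rintro x y ⟨g, l, k, h1, h2, h3, h4, h5, h6, h7⟩ ⟨g', l', k', i1, i2, i3, i4, i5, i6, i7⟩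
    refine ⟨g + g', l + l', k + k', h1.add i1, fun z hz => ?_, fun i => ?_, fun w => ?_,
      fun e => (h5 e).add (i5 e), fun e t => ?_, fun e => ?_⟩
    · simp [h2 z hz, i2 z hz, exp_add]
    · simp [h3, i3]
    · simp [h4, i4, exp_add]
    · simp [h6, i6, exp_add]
    · simp only [Pi.add_apply, Prod.snd_mul, toAdd_mul]
      push_cast
      linear_combination h7 e + i7 e
  inv_mem' := by
    rintro x ⟨g, l, k, h1, h2, h3, h4, h5, h6, h7⟩
    refine ⟨-g, -l, -k, h1.neg, fun z hz => ?_, fun i => ?_, fun w => ?_,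
      fun e => (h5 e).neg, fun e t => ?_, fun e => ?_⟩
    · simp [h2 z hz, exp_neg]
    · simp [h3]
    · simp [h4, exp_neg]
    · simp [h6, exp_neg]
    · simp only [Pi.neg_apply, Prod.snd_inv, toAdd_inv]
      push_cast
      linear_combination - h7 e

lemma isPreconnected_unitCircle : IsPreconnected (sphere (0 : ℂ) 1) :=
  isPreconnected_sphere (by simp [Complex.rank_real_complex]) _ _

/-- Along an arc, nonvanishing continuous functions have logarithms. -/
lemma exists_log_on_curve {e : E} {u : ℂ → ℂˣ}
    (hu : ContinuousOn (fun z => (u z : ℂ)) G.skeleton) :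
    ∃ k : unitInterval → ℂ, Continuous k ∧ ∀ t, (u (G.curve e t) : ℂ) = exp (k t) := by
  -- The arc is extended to the plane, as a function of the real part.
  set p : ℂ → unitInterval := fun z => projIcc 0 1 zero_le_one z.re
  have hp : Continuous p := continuous_projIcc.comp continuous_re
  obtain ⟨g, hg, hgu⟩ := mem_logOn_closedBall (u := fun z => u (G.curve e (p z))) (by
    refine ContinuousOn.comp (g := fun z => (u z : ℂ)) hu ?_ fun z _ => G.curve_mem_skeleton e (p z)
    exact ((G.curve e).continuous.comp hp).continuousOn)
  have hmem : ∀ t : unitInterval, ((t : ℝ) : ℂ) ∈ closedBall (0 : ℂ) 1 := fun t => by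
    rw [mem_closedBall_zero_iff, norm_real, Real.norm_eq_abs, abs_of_nonneg t.2.1]
    exact t.2.2
  refine ⟨fun t => g (t : ℝ), ?_, fun t => ?_⟩
  · rw [← continuousOn_univ]
    exact hg.comp (by fun_prop) fun t _ => hmem t
  · rw [← hgu _ (hmem t)]
    simp [p]

lemma exists_mem_windingGroup {u : ℂ → ℂˣ}
    (hu : ContinuousOn (fun z => (u z : ℂ)) G.skeleton) (hS : u ∈ logOn (sphere 0 1)) :
    ∃ c : E → ℤ, (u, Multiplicative.ofAdd c) ∈ G.windingGroup := by
  obtain ⟨g, hg, hgu⟩ := hS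
  have hsph : ∀ i, G.point (Sum.inr i) ∈ sphere (0 : ℂ) 1 := fun i => by
    simpa using G.norm_point_inr i
  choose k hk hku using fun e => G.exists_log_on_curve (e := e) hu
  set l : V ⊕ Fin n → ℂ := Sum.elim (fun v => log (u (G.pos v))) fun i => g (G.point (Sum.inr i))
  have hl : ∀ w, (u (G.point w) : ℂ) = exp (l w) := by
    rintro (v | i)
    · simp [l, point, exp_log]
    · exact hgu _ (hsph i)
  have hint : ∀ e, ∃ m : ℤ, k e 1 - k e 0 = l (G.tgt e) - l (G.src e) + m * (2 * Real.pi * I) := by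
    intro e
    refine exp_eq_exp_iff_exists_int.1 ?_
    rw [exp_sub, exp_sub, ← hku, ← hku, ← hl, ← hl, curve_one, curve_zero]
  choose c hc using hint
  exact ⟨c, g, l, k, hg, hgu, fun _ => rfl, hl, hk, hku, hc⟩

/-- The cochain of a function with a logarithm on the skeleton is a coboundary. -/
lemma exists_coboundary_eq {u : ℂ → ℂˣ} {c : E → ℤ}
    (h : (u, Multiplicative.ofAdd c) ∈ G.windingGroup) (hu : u ∈ logOn G.skeleton) :
    ∃ p : V → ℤ, G.coboundary ℤ p = c := by
  obtain ⟨g, l, k, h1, h2, h3, h4, h5, h6, h7⟩ := h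
  obtain ⟨f, hf, hfu⟩ := hu
  have hsph : ∀ i, G.point (Sum.inr i) ∈ sphere (0 : ℂ) 1 := fun i => by
    simpa using G.norm_point_inr i
  obtain ⟨m, hm⟩ := exists_int_of_exp_eq isPreconnected_unitCircle h1
    (hf.mono (fun z hz => Or.inl hz)) fun z hz => by rw [← h2 z hz, hfu z (Or.inl hz)]
  have hP : ∀ w, ∃ a : ℤ, l w = f (G.point w) + a * (2 * Real.pi * I) := fun w =>
    exp_eq_exp_iff_exists_int.1 (by rw [← h4, hfu _ (G.point_mem_skeleton w)])
  choose P hP using hP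
  have hPm : ∀ i, P (Sum.inr i) = m := by
    intro i
    have e1 := hP (Sum.inr i)
    rw [h3, hm _ (hsph i)] at e1
    have e2 : ((m : ℂ) - P (Sum.inr i)) * (2 * Real.pi * I) = 0 := by linear_combination e1
    have e3 := (mul_eq_zero.1 e2).resolve_right two_pi_I_ne_zero
    exact_mod_cast (sub_eq_zero.1 e3).symm
  refine ⟨fun v => m - P (Sum.inl v), funext fun e => ?_⟩
  have hext : ∀ w : V ⊕ Fin n, extendZero (fun v => m - P (Sum.inl v)) w = m - P w := by
    rintro (v | i)
    · rfl
    · simp [extendZero, hPm]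
  rw [coboundary_apply, hext, hext]
  obtain ⟨a, ha⟩ := exists_int_of_exp_eq (isPreconnected_univ (α := unitInterval))
    (h5 e).continuousOn (f := k e) (g := fun t => f (G.curve e t))
    (hf.comp (G.curve e).continuous.continuousOn fun t _ => G.curve_mem_skeleton e t)
    fun t _ => by rw [← h6, hfu _ (G.curve_mem_skeleton e t)]
  have e1 := h7 e
  rw [ha 1 trivial, ha 0 trivial, curve_one, curve_zero, hP, hP] at e1
  have e2 : ((m - P (G.tgt e) - (m - P (G.src e)) : ℂ) - c e) * (2 * Real.pi * I) = 0 := by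
    simp only [toAdd_ofAdd] at e1
    linear_combination e1
  have e3 := (mul_eq_zero.1 e2).resolve_right two_pi_I_ne_zero
  exact_mod_cast sub_eq_zero.1 e3

/-- A function whose cochain is a coboundary has a logarithm on the skeleton. -/
lemma mem_logOn_skeleton [Finite E] (hV : ∀ v, ∃ e, Sum.inl v ∈ G.ends e) {u : ℂ → ℂˣ} {p : V → ℤ}
    (h : (u, Multiplicative.ofAdd (G.coboundary ℤ p)) ∈ G.windingGroup) :
    u ∈ logOn G.skeleton := by
  classical
  obtain ⟨g, l, k, h1, h2, h3, h4, h5, h6, h7⟩ := h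
  -- Adjust the logarithms at the vertices and along the edges so that they fit together.
  set l' : V ⊕ Fin n → ℂ := fun w => l w + (extendZero p w : ℤ) * (2 * Real.pi * I) with hl'
  set k' : E → unitInterval → ℂ := fun e t => k e t + (l' (G.src e) - k e 0) with hk'
  have exp_l' : ∀ w, exp (l' w) = u (G.point w) := fun w => by
    rw [hl']; simp only; rw [exp_add, exp_int_mul_two_pi_mul_I, mul_one, h4]
  have hk'u : ∀ e t, (u (G.curve e t) : ℂ) = exp (k' e t) := fun e t => by
    rw [hk']; simp only
    rw [exp_add, exp_sub, exp_l', ← h6 e 0, ← h6 e t, curve_zero, div_self (Units.ne_zero _),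
      mul_one]
  have hk0 : ∀ e, k' e 0 = l' (G.src e) := fun e => by simp [hk']
  have hk1 : ∀ e, k' e 1 = l' (G.tgt e) := fun e => by
    have := h7 e
    simp only [toAdd_ofAdd, coboundary_apply] at this
    push_cast at this
    simp only [hk', hl']
    linear_combination this
  have hend : ∀ e t, t = 0 ∨ t = 1 → ∃ w, G.curve e t = G.point w ∧ k' e t = l' w := by
    rintro e t (rfl | rfl)
    · exact ⟨_, G.curve_zero e, hk0 e⟩
    · exact ⟨_, G.curve_one e, hk1 e⟩
  set f : ℂ → ℂ := fun z => if z ∈ sphere (0 : ℂ) 1 then g z else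
    if h : ∃ x : E × unitInterval, G.curve x.1 x.2 = z then k' h.choose.1 h.choose.2 else 0 with hf
  have hf1 : ∀ z ∈ sphere (0 : ℂ) 1, f z = g z := fun z hz => by simp only [hf, if_pos hz]
  have hf2 : ∀ e t, f (G.curve e t) = k' e t := by
    intro e t
    by_cases hz : G.curve e t ∈ sphere (0 : ℂ) 1
    · rw [hf1 _ hz]
      have ht : t = 0 ∨ t = 1 := by
        by_contra hne
        push Not at hne
        have := G.norm_curve_lt e t hne.1 hne.2
        rw [mem_sphere_zero_iff_norm] at hz
        linarith
      obtain ⟨w, hw1, hw2⟩ := hend e t ht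
      rcases w with v | i
      · have := G.norm_pos_lt v
        rw [mem_sphere_zero_iff_norm, hw1] at hz
        exact absurd hz this.ne
      · rw [hw2, hw1]
        simp [hl', extendZero, h3]
    · have hex : ∃ x : E × unitInterval, G.curve x.1 x.2 = G.curve e t := ⟨(e, t), rfl⟩
      simp only [hf, if_neg hz, dif_pos hex]
      have hc := hex.choose_spec
      generalize hex.choose = x at hc
      obtain ⟨e', t'⟩ := x
      by_cases he : e' = e
      · subst he
        rw [show t' = t from G.curve_injective e' hc]
      · obtain ⟨c1, c2⟩ := G.curve_eq_curve e' e he t' t hc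
        obtain ⟨w, hw1, hw2⟩ := hend e t c2
        obtain ⟨w', hw1', hw2'⟩ := hend e' t' c1
        have : w' = w := G.point_injective (by rw [← hw1, ← hw1', hc])
        simp only [hw2, hw2', this]
  refine ⟨f, G.continuousOn_skeleton hV (h1.congr hf1) fun e => ?_, ?_⟩
  · simp only [hf2]
    exact (h5 e).add continuous_const
  · intro z hz
    rw [G.skeleton_eq hV] at hz
    rcases hz with hz | hz
    · rw [hf1 z hz, h2 z hz]
    · obtain ⟨e, t, rfl⟩ := mem_iUnion.1 hz
      rw [hf2, hk'u]

/-- Each elementary cochain is realized by a function that turns once along one edge and is `1`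
elsewhere. -/
lemma exists_single_mem_windingGroup [Finite E] [DecidableEq E]
    (hV : ∀ v, ∃ e, Sum.inl v ∈ G.ends e) (e : E) :
    ∃ u : ℂ → ℂˣ, ContinuousOn (fun z => (u z : ℂ)) G.skeleton ∧
      (u, Multiplicative.ofAdd (Pi.single e 1)) ∈ G.windingGroup := by
  classical
  set u : ℂ → ℂˣ := fun z => if h : ∃ t, G.curve e t = z then
    Units.mk0 (exp ((h.choose : ℝ) * (2 * Real.pi * I))) (exp_ne_zero _) else 1 with hu
  have hue : ∀ t, (u (G.curve e t) : ℂ) = exp ((t : ℝ) * (2 * Real.pi * I)) := by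
    intro t
    have hex : ∃ t', G.curve e t' = G.curve e t := ⟨t, rfl⟩
    simp only [hu, dif_pos hex, Units.val_mk0]
    rw [G.curve_injective e hex.choose_spec]
  have hend : ∀ t, t = 0 ∨ t = 1 → (u (G.curve e t) : ℂ) = 1 := by
    rintro t (rfl | rfl)
    · simp [hue]
    · rw [hue]; simp
  have huS : ∀ z ∈ sphere (0 : ℂ) 1, (u z : ℂ) = 1 := by
    intro z hz
    by_cases h : ∃ t, G.curve e t = z
    · obtain ⟨t, rfl⟩ := h
      refine hend t ?_
      by_contra hne
      push Not at hne
      have := G.norm_curve_lt e t hne.1 hne.2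
      rw [mem_sphere_zero_iff_norm] at hz
      linarith
    · simp only [hu, dif_neg h, Units.val_one]
  have huf : ∀ f, f ≠ e → ∀ s, (u (G.curve f s) : ℂ) = 1 := by
    intro f hf s
    by_cases h : ∃ t, G.curve e t = G.curve f s
    · obtain ⟨t, ht⟩ := h
      rw [← ht]
      exact hend t (G.curve_eq_curve e f hf.symm t s ht).1
    · simp only [hu, dif_neg h, Units.val_one]
  have hup : ∀ w, (u (G.point w) : ℂ) = 1 := by
    intro w
    by_cases h : ∃ t, G.curve e t = G.point w
    · obtain ⟨t, ht⟩ := h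
      rw [← ht]
      refine hend t ?_
      rcases w with v | i
      · exact G.curve_eq_pos e t v ht
      · by_contra hne
        push Not at hne
        have := G.norm_curve_lt e t hne.1 hne.2
        rw [ht, norm_point_inr] at this
        exact lt_irrefl _ this
    · simp only [hu, dif_neg h, Units.val_one]
  refine ⟨u, G.continuousOn_skeleton hV ?_ fun f => ?_, 0, 0,
    fun f t => if f = e then (t : ℝ) * (2 * Real.pi * I) else 0, continuousOn_const, ?_, ?_, ?_,
    ?_, ?_, ?_⟩
  · exact continuousOn_const.congr huS
  · by_cases hf : f = e
    · subst hf
      simp only [hue]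
      fun_prop
    · simp only [huf f hf]
      exact continuous_const
  · intro z hz; simpa using huS z hz
  · simp
  · intro w; simpa using hup w
  · intro f
    by_cases hf : f = e
    · simp only [if_pos hf]; fun_prop
    · simp only [if_neg hf]; exact continuous_const
  · intro f t
    by_cases hf : f = e
    · subst hf
      simpa using hue t
    · simpa [hf] using huf f hf t
  · intro f
    by_cases hf : f = e
    · subst hf; simp
    · simp [hf]

end PlaneBipartiteGraph

namespace PlaneBipartiteGraph

open PlaneLog Complex Set Metric

variable {n : ℕ} {V E : Type*} (G : PlaneBipartiteGraph n V E)

/-! ### Counting faces -/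

/-- Near a point of the unit circle that is not a boundary vertex there are points of faces. -/
lemma nonempty_faces [Finite V] [Finite E] : Nonempty G.Faces := by
  obtain ⟨z, hz, hzG⟩ : ∃ z ∈ sphere (0 : ℂ) 1, z ∉ range G.point := by
    have hinf : (sphere (0 : ℂ) 1).Infinite :=
      isPreconnected_unitCircle.infinite_of_nontrivial ⟨1, by simp, -1, by simp, by norm_num⟩
    obtain ⟨z, h1, h2⟩ := (hinf.sdiff (finite_range G.point)).nonempty
    exact ⟨z, h1, h2⟩
  have hzs : z ∉ G.support := by
    rintro (h | h)
    · exact hzG h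
    · obtain ⟨e, t, rfl⟩ := mem_iUnion.1 h
      rw [mem_sphere_zero_iff_norm] at hz
      by_cases h0 : t = 0
      · exact hzG ⟨_, by rw [h0, curve_zero]⟩
      by_cases h1 : t = 1
      · exact hzG ⟨_, by rw [h1, curve_one]⟩
      exact (G.norm_curve_lt e t h0 h1).ne hz
  have hcl : z ∈ closure (ball (0 : ℂ) 1) := by
    rw [closure_ball 0 one_ne_zero]; exact sphere_subset_closedBall hz
  obtain ⟨y, hy1, hy2⟩ := mem_closure_iff.1 hcl _ G.isCompact_support.isClosed.isOpen_compl hzs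
  exact ⟨ConnectedComponents.mk ⟨y, hy2, hy1⟩⟩

/-- A chosen point of a face. -/
noncomputable def facePoint (F : G.Faces) : ℂ :=
  ((ConnectedComponents.surjective_coe F).choose : ↥(ball (0 : ℂ) 1 \ G.support))

lemma facePoint_mem (F : G.Faces) : G.facePoint F ∈ ball 0 1 \ G.skeleton := by
  rw [ball_sdiff_skeleton]
  exact (ConnectedComponents.surjective_coe F).choose.2

lemma exists_facePoint_mem {b : ℂ} (hb : b ∈ ball 0 1 \ G.skeleton) :
    ∃ F, G.facePoint F ∈ connectedComponentIn (ball 0 1 \ G.skeleton) b := by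
  rw [ball_sdiff_skeleton] at hb ⊢
  refine ⟨ConnectedComponents.mk ⟨b, hb⟩, ?_⟩
  rw [connectedComponentIn_eq_image hb]
  exact ⟨_, ConnectedComponents.coe_eq_coe'.1 (ConnectedComponents.surjective_coe
    (ConnectedComponents.mk (⟨b, hb⟩ : ↥(ball (0 : ℂ) 1 \ G.support)))).choose_spec, rfl⟩

lemma eq_of_facePoint_mem {F F' : G.Faces}
    (h : G.facePoint F ∈ connectedComponentIn (ball 0 1 \ G.skeleton) (G.facePoint F')) :
    F = F' := by
  have h' := G.facePoint_mem F'
  rw [ball_sdiff_skeleton] at h h'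
  rw [connectedComponentIn_eq_image h'] at h
  obtain ⟨x, hx, hxF⟩ := h
  have e1 : x = (ConnectedComponents.surjective_coe F).choose := Subtype.ext hxF
  subst e1
  have := ConnectedComponents.coe_eq_coe'.2 hx
  rw [(ConnectedComponents.surjective_coe F).choose_spec] at this
  rw [this]
  exact (ConnectedComponents.surjective_coe F').choose_spec

variable (F₀ : G.Faces)

/-- The function `z ↦ (z - a) / (z - a₀)`, for the chosen points `a` of the face `F` and `a₀` of
the face `F₀`. It has winding number zero along the unit circle. -/
noncomputable def faceUnit (F : G.Faces) : ℂ → ℂˣ :=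
  linearUnit (G.facePoint F) / linearUnit (G.facePoint F₀)

lemma continuousOn_faceUnit (F : G.Faces) :
    ContinuousOn (fun z => (G.faceUnit F₀ F z : ℂ)) G.skeleton := by
  have := (continuousOn_linearUnit (G.facePoint_mem F).2).div
    (continuousOn_linearUnit (G.facePoint_mem F₀).2) fun z _ => (linearUnit _ z).ne_zero
  simpa [Pi.div_def, faceUnit] using this

lemma faceUnit_mem_logOn_sphere (F : G.Faces) : G.faceUnit F₀ F ∈ logOn (sphere 0 1) := by
  have := div_mem (linearUnit_div_mem_logOn_sphere (G.facePoint_mem F).1)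
    (linearUnit_div_mem_logOn_sphere (G.facePoint_mem F₀).1)
  rwa [div_div_div_cancel_right] at this

lemma sphere_subset_skeleton : sphere 0 1 ⊆ G.skeleton := fun _ => Or.inl

lemma exists_faceCochain (F : G.Faces) :
    ∃ c : E → ℤ, (G.faceUnit F₀ F, Multiplicative.ofAdd c) ∈ G.windingGroup :=
  G.exists_mem_windingGroup (G.continuousOn_faceUnit F₀ F) (G.faceUnit_mem_logOn_sphere F₀ F)

/-- The cochain that represents the winding around the face `F` minus that around `F₀`. -/
noncomputable def faceCochain (F : G.Faces) : E → ℤ := (G.exists_faceCochain F₀ F).choose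

lemma faceUnit_mem_windingGroup (F : G.Faces) :
    (G.faceUnit F₀ F, Multiplicative.ofAdd (G.faceCochain F₀ F)) ∈ G.windingGroup :=
  (G.exists_faceCochain F₀ F).choose_spec

lemma prod_faceUnit_mem_windingGroup {ι : Type*} (s : Finset ι) (F : ι → G.Faces) (m : ι → ℤ) :
    (∏ i ∈ s, G.faceUnit F₀ (F i) ^ m i,
      Multiplicative.ofAdd (∑ i ∈ s, m i • G.faceCochain F₀ (F i))) ∈ G.windingGroup := by
  have h := prod_mem (S := G.windingGroup) (t := s)
    (f := fun i => (G.faceUnit F₀ (F i), Multiplicative.ofAdd (G.faceCochain F₀ (F i))) ^ m i)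
    fun i _ => zpow_mem (G.faceUnit_mem_windingGroup F₀ (F i)) (m i)
  convert h using 1
  ext1
  · simp [Prod.fst_prod]
  · apply Multiplicative.toAdd.injective
    simp [Prod.snd_prod, toAdd_prod]

lemma prod_zpow_eq_zpow_sum {ι A : Type*} [CommGroup A] (s : Finset ι) (f : ι → ℤ) (a : A) :
    ∏ i ∈ s, a ^ f i = a ^ ∑ i ∈ s, f i := by
  classical
  induction s using Finset.induction_on with
  | empty => simp
  | insert i s hi ih => rw [Finset.prod_insert hi, Finset.sum_insert hi, zpow_add, ih]

/-- Integral independence of the face cochains modulo coboundaries: winding numbers around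
different faces are independent. -/
lemma eq_zero_of_sum_faceCochain_eq [Finite V] [Finite E] (hV : ∀ v, ∃ e, Sum.inl v ∈ G.ends e)
    {ι : Type*} [DecidableEq ι] {s : Finset ι} {F : ι → G.Faces} (hF : Function.Injective F)
    (hF₀ : ∀ i, F i ≠ F₀) {m : ι → ℤ} {p : V → ℤ}
    (h : ∑ i ∈ s, m i • G.faceCochain F₀ (F i) = G.coboundary ℤ p) {j : ι} (hj : j ∈ s) :
    m j = 0 := by
  have h1 := G.prod_faceUnit_mem_windingGroup F₀ s F m
  rw [h] at h1
  have h2 := G.mem_logOn_skeleton hV h1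
  have hmem : ∀ {F' : G.Faces}, F' ≠ F j → linearUnit (G.facePoint F') ∈ linearGroup
      (closure (connectedComponentIn (ball 0 1 \ G.skeleton) (G.facePoint (F j)))) := fun hne =>
    linearUnit_mem_linearGroup fun hcl => hne <| G.eq_of_facePoint_mem <|
      closure_component_inter G.isCompact_skeleton.isClosed (G.facePoint_mem _) hcl
  refine eq_zero_of_mul_mem_logOn G.isCompact_skeleton.isClosed G.sphere_subset_skeleton
    (G.facePoint_mem (F j)) (n := m j)
    (r := (∏ i ∈ s.erase j, linearUnit (G.facePoint (F i)) ^ m i) *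
      (∏ i ∈ s, linearUnit (G.facePoint F₀) ^ m i)⁻¹) ?_ ?_
  · refine mul_mem (prod_mem fun i hi => zpow_mem (hmem fun hne => ?_) _)
      (inv_mem (prod_mem fun i _ => zpow_mem (hmem (hF₀ j).symm) _))
    exact (Finset.ne_of_mem_erase hi) (hF hne)
  · rw [← mul_assoc, Finset.mul_prod_erase s (fun i => linearUnit (G.facePoint (F i)) ^ m i) hj,
      ← div_eq_mul_inv, ← Finset.prod_div_distrib]
    simpa only [faceUnit, div_zpow] using h2

/-- The classes of face cochains generate all integral cochains modulo coboundaries. -/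
lemma exists_sum_faceCochain_eq [Finite V] [Finite E] [DecidableEq E]
    (hV : ∀ v, ∃ e, Sum.inl v ∈ G.ends e) (e : E) :
    ∃ (m : G.Faces →₀ ℤ) (p : V → ℤ),
      Pi.single e 1 = m.sum (fun F k => k • G.faceCochain F₀ F) + G.coboundary ℤ p := by
  obtain ⟨u, hu, huw⟩ := G.exists_single_mem_windingGroup hV e
  obtain ⟨l, hl, v, hv, rfl⟩ := Subgroup.mem_sup.1 (mem_logOn_sup_closure G.isCompact_skeleton
    G.skeleton_subset (fun b hb => G.exists_facePoint_mem hb) G.sphere_subset_skeleton hu)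
  obtain ⟨m, rfl⟩ := Subgroup.exists_finsupp_of_mem_closure_range _ _ hv
  have huS : l * m.prod (fun F k => linearUnit (G.facePoint F) ^ k) ∈ logOn (sphere 0 1) := by
    obtain ⟨g, _, _, h1, h2, _⟩ := huw
    exact ⟨g, h1, h2⟩
  -- The total exponent vanishes, because the function has winding number zero along the circle.
  have hsum : ∑ F ∈ m.support, m F = 0 := by
    refine eq_zero_of_zpow_mem_logOn_sphere ?_
    have h1 := (Subgroup.mul_mem_cancel_left _ (logOn_anti G.sphere_subset_skeleton hl)).1 huS
    have h2 : ∏ F ∈ m.support, (linearUnit (G.facePoint F) / linearUnit 0) ^ m F ∈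
        logOn (sphere 0 1) := prod_mem fun F _ =>
      zpow_mem (linearUnit_div_mem_logOn_sphere (G.facePoint_mem F).1) _
    have h3 := div_mem h1 h2
    rw [Finsupp.prod, ← Finset.prod_div_distrib] at h3
    simp only [div_zpow, div_div_cancel] at h3
    rwa [prod_zpow_eq_zpow_sum] at h3
  have hprod : m.prod (fun F k => linearUnit (G.facePoint F) ^ k) =
      ∏ F ∈ m.support, G.faceUnit F₀ F ^ m F := by
    simp only [faceUnit, div_zpow, Finset.prod_div_distrib]
    rw [prod_zpow_eq_zpow_sum, hsum, zpow_zero, div_one, Finsupp.prod]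
  rw [hprod] at huw
  have h4 := div_mem huw (G.prod_faceUnit_mem_windingGroup F₀ m.support id m)
  simp only [id] at h4
  rw [Prod.mk_div_mk, mul_div_cancel_right, ← ofAdd_sub] at h4
  obtain ⟨p, hp⟩ := G.exists_coboundary_eq h4 hl
  exact ⟨m, p, by rw [hp, Finsupp.sum]; abel⟩

/-- Euler's formula: the number of faces is one more than the dimension of the space of cochains
modulo coboundaries, the first cohomology of the graph in which the boundary vertices are
identified with each other. -/
theorem card_faces_eq [Finite V] [Finite E] (hV : ∀ v, ∃ e, Sum.inl v ∈ G.ends e) :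
    Finite G.Faces ∧ Module.finrank ℝ ((E → ℝ) ⧸ (G.coboundary ℝ).range) + 1 =
      Nat.card G.Faces := by
  classical
  cases nonempty_fintype E
  obtain ⟨F₀⟩ := G.nonempty_faces
  set N := (G.coboundary ℝ).range
  let cast : (E → ℤ) → E → ℝ := fun c e => c e
  set v : {F // F ≠ F₀} → (E → ℝ) ⧸ N := fun F => N.mkQ (cast (G.faceCochain F₀ F))
  have hind : LinearIndependent ℝ v := by
    rw [linearIndependent_iff']
    intro s g hg j hj
    have hmem : ∑ i ∈ s, g i • cast (G.faceCochain F₀ i) ∈ N := by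
      rw [← Submodule.Quotient.mk_eq_zero, ← Submodule.mkQ_apply, map_sum]
      simpa only [map_smul] using hg
    obtain ⟨p, hp⟩ := hmem
    by_contra hne
    -- A `ℚ`-linear functional makes the coefficients rational; then clear denominators.
    obtain ⟨φ, hφ⟩ := Module.Projective.exists_dual_ne_zero ℚ hne
    obtain ⟨⟨b, hb⟩, hbm⟩ := IsLocalization.exist_integer_multiples_of_finite (nonZeroDivisors ℤ)
      (Sum.elim (fun i : s => φ (g i)) fun w : V => φ (p w))
    have hb0 : b ≠ 0 := nonZeroDivisors.ne_zero hb
    have hm : ∀ i : {F // F ≠ F₀}, ∃ m : ℤ, i ∈ s → (m : ℚ) = b * φ (g i) := by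
      intro i
      by_cases hi : i ∈ s
      · obtain ⟨m, hm⟩ := hbm (Sum.inl ⟨i, hi⟩)
        exact ⟨m, fun _ => by simpa using hm⟩
      · exact ⟨0, fun h => absurd h hi⟩
    have hq : ∀ w : V, ∃ q : ℤ, (q : ℚ) = b * φ (p w) := by
      intro w
      obtain ⟨q, hq⟩ := hbm (Sum.inr w)
      exact ⟨q, by simpa using hq⟩
    choose m hm using hm
    choose q hq using hq
    have hext : ∀ w : V ⊕ Fin n, ((extendZero q w : ℤ) : ℚ) = b * φ (extendZero p w) := by
      rintro (w | i)
      · exact hq w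
      · simp [extendZero]
    have hsum : ∑ i ∈ s, m i • G.faceCochain F₀ i = G.coboundary ℤ q := by
      ext e
      have he := congrArg φ (congrFun hp e)
      rw [coboundary_apply, map_sub, Finset.sum_apply, map_sum] at he
      have hz : ∀ (x : ℝ) (k : ℤ), φ (x * k) = φ x * k := fun x k => by
        rw [mul_comm, ← zsmul_eq_mul, map_zsmul, zsmul_eq_mul, mul_comm]
      simp only [Pi.smul_apply, smul_eq_mul, cast, hz] at he
      rw [coboundary_apply, Finset.sum_apply]
      have : ((∑ i ∈ s, (m i • G.faceCochain F₀ i) e : ℤ) : ℚ) =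
          ((extendZero q (G.tgt e) - extendZero q (G.src e) : ℤ) : ℚ) := by
        push_cast
        rw [hext, hext, ← mul_sub, he, Finset.mul_sum]
        refine Finset.sum_congr rfl fun i hi => ?_
        rw [Pi.smul_apply, smul_eq_mul, Int.cast_mul, hm i hi, mul_assoc]
      exact_mod_cast this
    have := G.eq_zero_of_sum_faceCochain_eq F₀ hV Subtype.val_injective (fun i => i.2) hsum hj
    have h0 := hm j hj
    rw [this, Int.cast_zero, eq_comm, mul_eq_zero, Int.cast_eq_zero] at h0
    exact hφ (h0.resolve_left hb0)
  have hspan : ⊤ ≤ Submodule.span ℝ (range v) := by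
    have hle : ∀ c : E → ℤ, (∃ m : G.Faces →₀ ℤ, ∃ p : V → ℤ,
        c = m.sum (fun F k => k • G.faceCochain F₀ F) + G.coboundary ℤ p) →
        N.mkQ (cast c) ∈ Submodule.span ℝ (range v) := by
      rintro c ⟨m, p, rfl⟩
      have h1 : cast (m.sum (fun F k => k • G.faceCochain F₀ F) + G.coboundary ℤ p) =
          m.sum (fun F k => (k : ℝ) • cast (G.faceCochain F₀ F)) +
            G.coboundary ℝ (fun w => p w) := by
        ext e
        have hext : ∀ w : V ⊕ Fin n,
            ((extendZero p w : ℤ) : ℝ) = extendZero (fun w => (p w : ℝ)) w := by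
          rintro (w | i) <;> simp [extendZero]
        simp [cast, Finsupp.sum, coboundary_apply, hext]
      have h2 : N.mkQ (G.coboundary ℝ (fun w => p w)) = 0 := by
        rw [Submodule.mkQ_apply, Submodule.Quotient.mk_eq_zero]
        exact ⟨_, rfl⟩
      rw [h1, map_add, h2, add_zero, Finsupp.sum, map_sum]
      refine Submodule.sum_mem _ fun F _ => ?_
      rw [map_smul]
      refine Submodule.smul_mem _ _ ?_
      by_cases hF : F = F₀
      -- For `F = F₀` the function is constant, so that its cochain is a coboundary.
      · subst hF
        have h1 : G.faceUnit F F ∈ logOn G.skeleton := by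
          rw [faceUnit, div_self']; exact one_mem _
        obtain ⟨p', hp'⟩ := G.exists_coboundary_eq (G.faceUnit_mem_windingGroup F F) h1
        have : cast (G.faceCochain F F) = G.coboundary ℝ (fun w => p' w) := by
          ext e
          have hext : ∀ w : V ⊕ Fin n,
              ((extendZero p' w : ℤ) : ℝ) = extendZero (fun w => (p' w : ℝ)) w := by
            rintro (w | i) <;> simp [extendZero]
          simp [cast, ← hp', coboundary_apply, hext]
        rw [this, Submodule.mkQ_apply, (Submodule.Quotient.mk_eq_zero N).2 ⟨_, rfl⟩]
        exact zero_mem _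
      · exact Submodule.subset_span ⟨⟨F, hF⟩, rfl⟩
    intro x _
    obtain ⟨x, rfl⟩ := N.mkQ_surjective x
    rw [pi_eq_sum_univ' x, map_sum]
    refine Submodule.sum_mem _ fun e _ => ?_
    rw [map_smul]
    refine Submodule.smul_mem _ _ ?_
    have := hle _ (G.exists_sum_faceCochain_eq F₀ hV e)
    convert this using 2
    ext f
    simp [cast, Pi.single_apply]
  have hfin : Finite {F // F ≠ F₀} := hind.finite
  have hfin' : Finite G.Faces := by
    have : Finite ({F₀}ᶜ : Set G.Faces) := hfin
    exact Set.finite_univ_iff.1 (by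
      rw [← Set.union_compl_self {F₀}]
      exact (Set.finite_singleton F₀).union (Set.toFinite _))
  refine ⟨hfin', ?_⟩
  cases nonempty_fintype G.Faces
  rw [Module.finrank_eq_card_basis (Module.Basis.mk hind hspan), Nat.card_eq_fintype_card,
    Fintype.card_subtype_compl, Fintype.card_subtype_eq]
  have : 0 < Fintype.card G.Faces := Fintype.card_pos_iff.2 ⟨F₀⟩
  omega

end PlaneBipartiteGraph

namespace PlaneBipartiteGraph

open Set

variable {n : ℕ} {V E : Type*} (G : PlaneBipartiteGraph n V E)

/-! ### The incidence matrix of the internal vertices -/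

open Classical in
/-- The incidence matrix of the internal vertices and the edges, without signs. -/
noncomputable def incidence : Matrix V E ℝ := fun v e => if Sum.inl v ∈ G.ends e then 1 else 0

lemma src_ne_tgt (e : E) : G.src e ≠ G.tgt e := by
  have := G.ends_not_isDiag e
  rwa [ends_eq, Sym2.mk_isDiag_iff] at this

lemma sum_incidence_mul [Fintype V] (q : V → ℝ) (e : E) :
    ∑ v, G.incidence v e * q v = extendZero q (G.src e) + extendZero q (G.tgt e) := by
  classical
  have hone : ∀ w : V ⊕ Fin n, ∑ v, (if Sum.inl v = w then q v else 0) = extendZero q w := by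
    rintro (u | i) <;> simp [extendZero]
  rw [← hone, ← hone, ← Finset.sum_add_distrib]
  refine Finset.sum_congr rfl fun v _ => ?_
  have hne := G.src_ne_tgt e
  simp only [incidence, ends_eq, Sym2.mem_iff]
  by_cases h1 : Sum.inl v = G.src e
  · have h2 : Sum.inl v ≠ G.tgt e := fun h => hne (h1.symm.trans h)
    simp [h1, hne]
  · simp [h1]

/-- The sign of an internal vertex given by its colour. -/
def sign (v : V) : ℝ :=
  match G.color v with
  | .black => 1
  | .white => -1

lemma sign_mul_self (v : V) : G.sign v * G.sign v = 1 := by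
  unfold sign; cases G.color v <;> norm_num

lemma sign_add_sign {e : E} {u v : V} (h : G.ends e = s(Sum.inl u, Sum.inl v)) :
    G.sign u + G.sign v = 0 := by
  have := G.color_ne e u v h
  unfold sign
  generalize G.color u = a at this ⊢
  generalize G.color v = b at this ⊢
  cases a <;> cases b <;> simp_all

/-- Up to the signs of the vertices given by their colours and up to signs of the edges, the
transposed incidence matrix is the coboundary map. -/
lemma exists_sign_coboundary [Fintype V] (e : E) : ∃ ε : ℝ, ε * ε = 1 ∧ ∀ q : V → ℝ,
    ε * G.coboundary ℝ (fun v => G.sign v * q v) e = ∑ v, G.incidence v e * q v := by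
  simp only [sum_incidence_mul, coboundary_apply]
  have he := G.ends_eq e
  generalize G.src e = a at he ⊢
  generalize G.tgt e = b at he ⊢
  rcases a with u | i <;> rcases b with v | j
  · refine ⟨G.sign v, G.sign_mul_self v, fun q => ?_⟩
    have h1 := G.sign_add_sign he
    have h2 := G.sign_mul_self v
    simp only [extendZero, Sum.elim_inl]
    linear_combination q u * h2 + q v * h2 - G.sign v * q u * h1
  · refine ⟨-G.sign u, by linear_combination G.sign_mul_self u, fun q => ?_⟩
    simp only [extendZero, Sum.elim_inl, Sum.elim_inr]
    linear_combination q u * G.sign_mul_self u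
  · refine ⟨G.sign v, G.sign_mul_self v, fun q => ?_⟩
    simp only [extendZero, Sum.elim_inl, Sum.elim_inr]
    linear_combination q v * G.sign_mul_self v
  · exact ⟨1, by norm_num, fun q => by simp [extendZero]⟩

/-- Multiplication by a family of signs, as a linear equivalence. -/
def signEquiv {ι : Type*} (ε : ι → ℝ) (hε : ∀ i, ε i * ε i = 1) : (ι → ℝ) ≃ₗ[ℝ] (ι → ℝ) :=
  LinearEquiv.ofInvolutive (LinearMap.mulLeft ℝ ε) fun x => by
    ext i; simp [← mul_assoc, hε]

lemma rank_incidence [Fintype V] [Fintype E] :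
    G.incidence.rank = Module.finrank ℝ (G.coboundary ℝ).range := by
  choose ε hε h using G.exists_sign_coboundary
  have : G.incidence.transpose.mulVecLin =
      (signEquiv ε hε).toLinearMap ∘ₗ G.coboundary ℝ ∘ₗ
        (signEquiv G.sign G.sign_mul_self).toLinearMap := by
    ext1 q
    ext e
    simp only [Matrix.mulVecLin_apply, Matrix.mulVec, dotProduct, Matrix.transpose_apply, ← h e q]
    rfl
  rw [← Matrix.rank_transpose, Matrix.rank, this, LinearMap.range_comp, LinearEquiv.finrank_map_eq,
    LinearMap.range_comp_of_range_eq_top _ (LinearEquiv.range _)]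

/-! ### The matching polytope is cut out by the vertex equations -/

/-- The fractional almost perfect matchings. -/
def fractional [Fintype E] : Set (E → ℝ) :=
  {x | (∀ e, 0 ≤ x e) ∧ (∀ e, x e ≤ 1) ∧ G.incidence.mulVec x = 1}

variable {G}

lemma sum_eq_one_of_mem_fractional [Fintype E] {x : E → ℝ} (hx : x ∈ G.fractional) (v : V) :
    ∑ e, G.incidence v e * x e = 1 := congrFun hx.2.2 v

lemma incidence_nonneg (v : V) (e : E) : 0 ≤ G.incidence v e := by
  unfold incidence; split_ifs <;> norm_num

lemma IsAlmostPerfectMatching.mulVec_indicator [Fintype E] {M : Set E}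
    (hM : G.IsAlmostPerfectMatching M) : G.incidence.mulVec (M.indicator 1) = 1 := by
  classical
  ext v
  obtain ⟨e, ⟨he, hve⟩, huniq⟩ := hM v
  change ∑ f, G.incidence v f * M.indicator 1 f = 1
  rw [Finset.sum_eq_single e]
  · simp [incidence, hve, he]
  · intro f _ hf
    by_cases hfM : f ∈ M
    · have : Sum.inl v ∉ G.ends f := fun h => hf (huniq f ⟨hfM, h⟩)
      simp [incidence, this]
    · simp [hfM]
  · simp

lemma IsAlmostPerfectMatching.indicator_mem_fractional [Fintype E] {M : Set E}
    (hM : G.IsAlmostPerfectMatching M) : M.indicator 1 ∈ G.fractional :=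
  ⟨fun e => indicator_nonneg (by simp) e, fun e => by by_cases h : e ∈ M <;> simp [h],
    hM.mulVec_indicator⟩

lemma isAlmostPerfectMatching_of_mem_fractional [Fintype E] {x : E → ℝ} (hx : x ∈ G.fractional)
    (h01 : ∀ e, x e = 0 ∨ x e = 1) :
    G.IsAlmostPerfectMatching {e | x e = 1} ∧ x = {e | x e = 1}.indicator 1 := by
  classical
  refine ⟨fun v => ?_, ?_⟩
  · have hsum := sum_eq_one_of_mem_fractional hx v
    have hcard : ∑ e, G.incidence v e * x e =
        (Finset.univ.filter fun e => x e = 1 ∧ Sum.inl v ∈ G.ends e).card := by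
      rw [Finset.card_filter]
      push_cast
      refine Finset.sum_congr rfl fun e _ => ?_
      rcases h01 e with h | h <;> simp [h, incidence]
    rw [hcard] at hsum
    obtain ⟨e, he⟩ := Finset.card_eq_one.1 (by exact_mod_cast hsum)
    have hmem : ∀ f, (x f = 1 ∧ Sum.inl v ∈ G.ends f) ↔ f = e := fun f => by
      simpa using congrArg (f ∈ ·) he
    exact ⟨e, (hmem e).2 rfl, fun f hf => (hmem f).1 hf⟩
  · ext e
    rcases h01 e with h | h <;> simp [indicator, h]

/-- A nonempty set `F` of edges that meets each internal vertex in no edge or in at least two edges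
carries a nonzero solution of the homogeneous vertex equations. If not, there are as many edges in
`F` as internal vertices on them, each edge has two internal endpoints, and the equations would have
full rank; but their alternating sum is zero, since the endpoints of an edge differ in colour. -/
lemma exists_mulVec_eq_zero [Fintype V] [Fintype E] {F : Finset E} (hF : F.Nonempty)
    (hdeg : ∀ e ∈ F, ∀ v : V, Sum.inl v ∈ G.ends e → ∃ f ∈ F, f ≠ e ∧ Sum.inl v ∈ G.ends f) :
    ∃ y : E → ℝ, y ≠ 0 ∧ (∀ e ∉ F, y e = 0) ∧ G.incidence.mulVec y = 0 := by
  classical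
  set W : Finset V := Finset.univ.filter fun v => ∃ e ∈ F, Sum.inl v ∈ G.ends e with hW
  have hWmem : ∀ v, v ∈ W ↔ ∃ e ∈ F, Sum.inl v ∈ G.ends e := fun v => by simp [hW]
  set B := (G.incidence.submatrix (Subtype.val : W → V) (Subtype.val : F → E)).mulVecLin with hB
  have hBapp : ∀ (y : F → ℝ) (v : W), B y v = ∑ e : F, G.incidence v e * y e := fun _ _ => rfl
  by_cases hinj : Function.Injective B
  · exfalso
    have h1 : F.card ≤ W.card := by
      simpa using LinearMap.finrank_le_finrank_of_injective hinj
    -- Count the incidences between `F` and the internal vertices in two ways.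
    have hcount : ∑ v ∈ W, (Finset.bipartiteAbove (fun v e => Sum.inl v ∈ G.ends e) F v).card =
        ∑ e ∈ F, (Finset.bipartiteBelow (fun v e => Sum.inl v ∈ G.ends e) W e).card :=
      Finset.sum_card_bipartiteAbove_eq_sum_card_bipartiteBelow _
    have hlow : W.card * 2 ≤
        ∑ v ∈ W, (Finset.bipartiteAbove (fun v e => Sum.inl v ∈ G.ends e) F v).card := by
      rw [← smul_eq_mul]
      refine Finset.card_nsmul_le_sum _ _ _ fun v hv => ?_
      obtain ⟨e, he, hve⟩ := (hWmem v).1 hv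
      obtain ⟨f, hf, hfe, hvf⟩ := hdeg e he v hve
      rw [Nat.succ_le_iff, Finset.one_lt_card]
      exact ⟨e, by simp [he, hve], f, by simp [hf, hvf], hfe.symm⟩
    have hbelow : ∀ e ∈ F,
        ((Finset.bipartiteBelow (fun v e => Sum.inl v ∈ G.ends e) W e).card : ℝ) =
          extendZero (1 : V → ℝ) (G.src e) + extendZero (1 : V → ℝ) (G.tgt e) := by
      intro e he
      rw [← sum_incidence_mul]
      have : Finset.bipartiteBelow (fun v e => Sum.inl v ∈ G.ends e) W e =
          Finset.univ.filter fun v => Sum.inl v ∈ G.ends e := by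
        ext v
        simp only [Finset.mem_bipartiteBelow, Finset.mem_filter, Finset.mem_univ, true_and, hWmem]
        exact ⟨fun h => h.2, fun h => ⟨⟨e, he, h⟩, h⟩⟩
      rw [this, Finset.card_filter]
      push_cast
      simp [incidence]
    have hle : ∀ w : V ⊕ Fin n, extendZero (1 : V → ℝ) w ≤ 1 := by
      rintro (v | i) <;> simp [extendZero]
    have hup : ∀ e ∈ F, (Finset.bipartiteBelow (fun v e => Sum.inl v ∈ G.ends e) W e).card ≤ 2 := by
      intro e he
      have h2 := hbelow e he
      have h3 := hle (G.src e)
      have h4 := hle (G.tgt e)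
      have : ((Finset.bipartiteBelow (fun v e => Sum.inl v ∈ G.ends e) W e).card : ℝ) ≤ 2 := by
        linarith
      exact_mod_cast this
    have hsum_le := Finset.sum_le_card_nsmul _ _ _ hup
    rw [smul_eq_mul] at hsum_le
    have hcard : F.card = W.card := by omega
    have hall : ∀ e ∈ F,
        (Finset.bipartiteBelow (fun v e => Sum.inl v ∈ G.ends e) W e).card = 2 := by
      refine (Finset.sum_eq_sum_iff_of_le hup).1 ?_
      rw [Finset.sum_const, smul_eq_mul]
      omega
    have hsurj : Function.Surjective B :=
      (LinearMap.injective_iff_surjective_of_finrank_eq_finrank (by simpa using hcard)).1 hinj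
    -- Each edge of `F` joins internal vertices of different colours.
    have hsign : ∀ e ∈ F, ∑ v ∈ W, G.incidence v e * G.sign v = 0 := by
      intro e he
      have h0 : ∑ v ∈ W, G.incidence v e * G.sign v = ∑ v, G.incidence v e * G.sign v := by
        refine Finset.sum_subset (Finset.subset_univ _) fun v _ hv => ?_
        have : Sum.inl v ∉ G.ends e := fun h => hv ((hWmem v).2 ⟨e, he, h⟩)
        simp [incidence, this]
      rw [h0, sum_incidence_mul]
      have h2 := hbelow e he
      rw [hall e he] at h2
      have hends := G.ends_eq e
      generalize G.src e = a at h2 hends ⊢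
      generalize G.tgt e = b at h2 hends ⊢
      rcases a with u | i <;> rcases b with v | j
      · exact G.sign_add_sign hends
      all_goals simp [extendZero] at h2
    obtain ⟨e, he⟩ := hF
    have hpos : 0 < (Finset.bipartiteBelow (fun v e => Sum.inl v ∈ G.ends e) W e).card := by
      rw [hall e he]; norm_num
    obtain ⟨v₀, hv₀⟩ := Finset.card_pos.1 hpos
    have hv₀W : v₀ ∈ W := (Finset.mem_bipartiteBelow _).1 hv₀ |>.1
    obtain ⟨y, hy⟩ := hsurj (Pi.single ⟨v₀, hv₀W⟩ 1)
    have e1 : ∑ v : W, G.sign v * B y v = G.sign v₀ := by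
      rw [hy, Finset.sum_eq_single ⟨v₀, hv₀W⟩]
      · simp
      · intro v _ hv; simp [hv]
      · simp
    have e2 : ∑ v : W, G.sign v * B y v = 0 := by
      simp only [hBapp, Finset.mul_sum]
      rw [Finset.sum_comm]
      refine Finset.sum_eq_zero fun f _ => ?_
      have h3 := hsign f f.2
      rw [← Finset.sum_coe_sort] at h3
      calc ∑ v : W, G.sign v * (G.incidence v f * y f)
          = (∑ v : W, G.incidence v f * G.sign v) * y f := by
            rw [Finset.sum_mul]; exact Finset.sum_congr rfl fun _ _ => by ring
        _ = 0 := by rw [h3, zero_mul]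
    have := G.sign_mul_self v₀
    rw [← e1, e2] at this
    norm_num at this
  · rw [← LinearMap.ker_eq_bot, Submodule.eq_bot_iff] at hinj
    push Not at hinj
    obtain ⟨y, hy, hy0⟩ := hinj
    set z : E → ℝ := fun e => if h : e ∈ F then y ⟨e, h⟩ else 0 with hz
    have hzF : ∀ e : F, z e = y e := fun e => by simp [hz]
    have hz0 : ∀ e ∉ F, z e = 0 := fun e he => by simp [hz, he]
    refine ⟨z, fun h => hy0 ?_, hz0, ?_⟩
    · ext e
      rw [← hzF, h]; rfl
    · ext v
      change ∑ e, G.incidence v e * z e = 0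
      rw [← Finset.sum_subset (Finset.subset_univ F) fun e _ he => by rw [hz0 e he, mul_zero],
        ← Finset.sum_coe_sort]
      simp only [hzF]
      by_cases hv : v ∈ W
      · rw [← hBapp y ⟨v, hv⟩, LinearMap.mem_ker.1 hy]; rfl
      · refine Finset.sum_eq_zero fun e _ => ?_
        have : Sum.inl v ∉ G.ends e := fun h => hv ((hWmem v).2 ⟨e, e.2, h⟩)
        simp [incidence, this]

/-- For small `ε`, moving by `ε y` preserves the inequalities that are strict. -/
lemma exists_pos_forall_add_mem [Finite E] {x y : E → ℝ} {p : E → Prop}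
    (hx : ∀ e, p e → 0 < x e ∧ x e < 1) :
    ∃ ε > (0 : ℝ), ∀ e, p e → ∀ s, |s| ≤ ε → 0 ≤ x e + s * y e ∧ x e + s * y e ≤ 1 := by
  have hev : ∀ᶠ s in nhds (0 : ℝ), ∀ e, p e → 0 < x e + s * y e ∧ x e + s * y e < 1 := by
    rw [Filter.eventually_all]
    intro e
    by_cases hp : p e
    · have hc : Filter.Tendsto (fun s => x e + s * y e) (nhds 0) (nhds (x e + 0 * y e)) :=
        (Continuous.tendsto (by fun_prop) 0)
      rw [zero_mul, add_zero] at hc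
      filter_upwards [hc.eventually_const_lt (hx e hp).1, hc.eventually_lt_const (hx e hp).2]
        with s h1 h2 _ using ⟨h1, h2⟩
    · exact Filter.Eventually.of_forall fun s h => absurd h hp
  obtain ⟨ε, hε, h⟩ := Metric.eventually_nhds_iff.1 hev
  refine ⟨ε / 2, by positivity, fun e he s hs => ?_⟩
  have := h (y := s) (by rw [Real.dist_eq, sub_zero]; linarith) e he
  exact ⟨this.1.le, this.2.le⟩

/-- The extreme points of the polytope of fractional almost perfect matchings are integral. -/
lemma eq_zero_or_one_of_mem_extremePoints [Fintype V] [Fintype E] {x : E → ℝ}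
    (hx : x ∈ extremePoints ℝ G.fractional) (e : E) : x e = 0 ∨ x e = 1 := by
  classical
  have hxF := hx.1
  by_contra hne
  push Not at hne
  set F : Finset E := Finset.univ.filter fun e => 0 < x e ∧ x e < 1 with hFdef
  have hFmem : ∀ e, e ∈ F ↔ 0 < x e ∧ x e < 1 := fun e => by simp [hFdef]
  have heF : e ∈ F := (hFmem e).2
    ⟨lt_of_le_of_ne (hxF.1 e) hne.1.symm, lt_of_le_of_ne (hxF.2.1 e) hne.2⟩
  -- The edges at a vertex have total weight one, so they cannot contain just one fractional edge.
  have hdeg : ∀ e ∈ F, ∀ v : V, Sum.inl v ∈ G.ends e →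
      ∃ f ∈ F, f ≠ e ∧ Sum.inl v ∈ G.ends f := by
    intro e he v hve
    have hsum := sum_eq_one_of_mem_fractional hxF v
    rw [← Finset.add_sum_erase _ _ (Finset.mem_univ e)] at hsum
    have hie : G.incidence v e = 1 := by simp [incidence, hve]
    rw [hie, one_mul] at hsum
    have he' := (hFmem e).1 he
    obtain ⟨f, hf, hpos⟩ : ∃ f ∈ Finset.univ.erase e, 0 < G.incidence v f * x f := by
      by_contra hno
      push Not at hno
      have := Finset.sum_nonpos hno
      linarith
    have hvf : Sum.inl v ∈ G.ends f := by
      by_contra h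
      simp [incidence, h] at hpos
    have hif : G.incidence v f = 1 := by simp [incidence, hvf]
    rw [hif, one_mul] at hpos
    have hle : G.incidence v f * x f ≤ ∑ f ∈ Finset.univ.erase e, G.incidence v f * x f :=
      Finset.single_le_sum (fun f _ => mul_nonneg (incidence_nonneg v f) (hxF.1 f)) hf
    rw [hif, one_mul] at hle
    exact ⟨f, (hFmem f).2 ⟨hpos, by linarith⟩, Finset.ne_of_mem_erase hf, hvf⟩
  obtain ⟨y, hy0, hyF, hy⟩ := exists_mulVec_eq_zero ⟨e, heF⟩ hdeg
  obtain ⟨ε, hε, hbound⟩ := exists_pos_forall_add_mem (x := x) (y := y) (p := (· ∈ F))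
    fun e he => (hFmem e).1 he
  have hmem : ∀ s : ℝ, |s| ≤ ε → x + s • y ∈ G.fractional := by
    intro s hs
    refine ⟨fun f => ?_, fun f => ?_, ?_⟩
    · by_cases hf : f ∈ F
      · exact (hbound f hf s hs).1
      · simpa [hyF f hf] using hxF.1 f
    · by_cases hf : f ∈ F
      · exact (hbound f hf s hs).2
      · simpa [hyF f hf] using hxF.2.1 f
    · rw [Matrix.mulVec_add, Matrix.mulVec_smul, hy, smul_zero, add_zero, hxF.2.2]
  have hε' : |ε| ≤ ε := (abs_of_pos hε).le
  have hmid : x ∈ openSegment ℝ (x + ε • y) (x + (-ε) • y) := by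
    refine ⟨1 / 2, 1 / 2, by norm_num, by norm_num, by norm_num, ?_⟩
    ext f
    simp
    ring
  have := hx.2 (hmem ε hε') (hmem (-ε) (by rwa [abs_neg])) hmid
  rw [add_eq_left, smul_eq_zero] at this
  exact hy0 (this.resolve_left hε.ne')

lemma matchingPolytope_eq [Fintype V] [Fintype E] : G.matchingPolytope = G.fractional := by
  have hconv : Convex ℝ G.fractional := by
    rintro x ⟨hx0, hx1, hx⟩ y ⟨hy0, hy1, hy⟩ a b ha hb hab
    refine ⟨fun e => ?_, fun e => ?_, ?_⟩
    · have h1 := mul_nonneg ha (hx0 e)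
      have h2 := mul_nonneg hb (hy0 e)
      simpa using add_nonneg h1 h2
    · have h1 := mul_le_mul_of_nonneg_left (hx1 e) ha
      have h2 := mul_le_mul_of_nonneg_left (hy1 e) hb
      simp only [Pi.add_apply, Pi.smul_apply, smul_eq_mul]
      linarith
    · rw [Matrix.mulVec_add, Matrix.mulVec_smul, Matrix.mulVec_smul, hx, hy, ← add_smul, hab,
        one_smul]
  have hcomp : IsCompact G.fractional := by
    have hcl : IsClosed {x : E → ℝ | G.incidence.mulVec x = 1} :=
      isClosed_eq (by fun_prop) continuous_const
    have : G.fractional = Set.Icc 0 1 ∩ {x : E → ℝ | G.incidence.mulVec x = 1} := by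
      ext x
      exact ⟨fun h => ⟨⟨h.1, h.2.1⟩, h.2.2⟩, fun h => ⟨h.1.1, h.1.2, h.2⟩⟩
    rw [this]
    exact isCompact_Icc.inter_right hcl
  refine Subset.antisymm (convexHull_min ?_ hconv) ?_
  · rintro _ ⟨M, hM, rfl⟩
    exact hM.indicator_mem_fractional
  · have hfin : {x : E → ℝ | ∃ M : Set E, G.IsAlmostPerfectMatching M ∧ x = M.indicator 1}.Finite :=
      (Set.finite_range fun M : Set E => (M.indicator 1 : E → ℝ)).subset
        (by rintro _ ⟨M, -, rfl⟩; exact ⟨M, rfl⟩)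
    rw [← closure_convexHull_extremePoints hcomp hconv]
    refine closure_minimal (convexHull_mono fun x hx => ?_) (hfin.isCompact_convexHull ℝ).isClosed
    exact ⟨_, isAlmostPerfectMatching_of_mem_fractional hx.1
      (eq_zero_or_one_of_mem_extremePoints hx)⟩

/-- The average of all almost perfect matchings lies in the relative interior of the polytope. -/
lemma exists_mem_fractional_pos [Fintype V] [Fintype E]
    (hG : ∃ M : Set E, G.IsAlmostPerfectMatching M)
    (hE : ∀ e : E, ∃ M : Set E, G.IsAlmostPerfectMatching M ∧ e ∈ M) :
    ∃ x ∈ G.fractional, (∀ e, 0 < x e) ∧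
      ∀ e, (∀ v : V, Sum.inl v ∉ G.ends e) → x e < 1 := by
  classical
  set T : Finset (Set E) := Finset.univ.filter G.IsAlmostPerfectMatching with hT
  have hTmem : ∀ M, M ∈ T ↔ G.IsAlmostPerfectMatching M := fun M => by simp [hT]
  have hTpos : (0 : ℝ) < T.card := by
    obtain ⟨M, hM⟩ := hG
    exact_mod_cast Finset.card_pos.2 ⟨M, (hTmem M).2 hM⟩
  set x : E → ℝ := ∑ M ∈ T, (T.card : ℝ)⁻¹ • (M.indicator 1 : E → ℝ) with hx
  have hxe : ∀ e, x e = (T.card : ℝ)⁻¹ * ∑ M ∈ T, (M.indicator 1 : E → ℝ) e := fun e => by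
    simp [hx, Finset.mul_sum]
  have hind0 : ∀ (M : Set E) e, (0 : ℝ) ≤ (M.indicator 1 : E → ℝ) e := fun M e =>
    indicator_nonneg (by simp) e
  have hind1 : ∀ (M : Set E) e, (M.indicator 1 : E → ℝ) e ≤ 1 := fun M e =>
    by by_cases h : e ∈ M <;> simp [h]
  have hxmem : x ∈ G.fractional := by
    rw [← matchingPolytope_eq]
    refine (convex_convexHull ℝ _).sum_mem (fun _ _ => inv_nonneg.2 hTpos.le) ?_
      fun M hM => subset_convexHull ℝ _ ⟨M, (hTmem M).1 hM, rfl⟩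
    rw [Finset.sum_const, nsmul_eq_mul, mul_inv_cancel₀ hTpos.ne']
  refine ⟨x, hxmem, fun e => ?_, fun e he => ?_⟩
  · rw [hxe]
    obtain ⟨M, hM, heM⟩ := hE e
    refine mul_pos (inv_pos.2 hTpos) (Finset.sum_pos' (fun M _ => hind0 M e)
      ⟨M, (hTmem M).2 hM, by simp [heM]⟩)
  -- An edge between boundary vertices can be removed from an almost perfect matching.
  · rw [hxe, inv_mul_lt_iff₀ hTpos, mul_one]
    obtain ⟨M, hM⟩ := hG
    have hM' : G.IsAlmostPerfectMatching (M \ {e}) := by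
      intro v
      obtain ⟨f, ⟨hf, hvf⟩, huniq⟩ := hM v
      exact ⟨f, ⟨⟨hf, fun h => he v (h ▸ hvf)⟩, hvf⟩, fun g hg => huniq g ⟨hg.1.1, hg.2⟩⟩
    calc ∑ M ∈ T, (M.indicator 1 : E → ℝ) e < ∑ M ∈ T, (1 : ℝ) :=
          Finset.sum_lt_sum (fun M _ => hind1 M e) ⟨M \ {e}, (hTmem _).2 hM', by simp⟩
      _ = T.card := by simp

/-- The directions of the affine hull of the polytope are the solutions of the homogeneous vertex
equations. -/
lemma direction_affineSpan_matchingPolytope [Fintype V] [Fintype E]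
    (hG : ∃ M : Set E, G.IsAlmostPerfectMatching M)
    (hE : ∀ e : E, ∃ M : Set E, G.IsAlmostPerfectMatching M ∧ e ∈ M) :
    (affineSpan ℝ G.matchingPolytope).direction = G.incidence.mulVecLin.ker := by
  classical
  rw [matchingPolytope_eq]
  refine le_antisymm ?_ fun y hy => ?_
  · rw [direction_affineSpan, vectorSpan, Submodule.span_le]
    rintro _ ⟨x, hx, y, hy, rfl⟩
    change G.incidence.mulVec (x - y) = 0
    rw [Matrix.mulVec_sub, hx.2.2, hy.2.2, sub_self]
  · have hy0 : G.incidence.mulVec y = 0 := hy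
    obtain ⟨x, hx, hpos, hlt⟩ := exists_mem_fractional_pos hG hE
    -- At an edge of weight one with an internal endpoint, only the lower bound is needed, so that
    -- the bounds are applied to half of the weights.
    obtain ⟨ε, hε, hbound⟩ := exists_pos_forall_add_mem (x := fun e => x e / 2) (y := y)
      (p := fun _ => True) fun e _ => ⟨by linarith [hpos e], by linarith [hx.2.1 e]⟩
    obtain ⟨ε', hε', hbound'⟩ := exists_pos_forall_add_mem (x := x) (y := y)
      (p := fun e => ∀ v : V, Sum.inl v ∉ G.ends e) fun e he => ⟨hpos e, hlt e he⟩
    set s := min ε ε' with hs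
    have hspos : 0 < s := lt_min hε hε'
    have h0 : ∀ e, 0 ≤ x e + s * y e := fun e => by
      have := (hbound e trivial s (by rw [abs_of_pos hspos]; exact min_le_left _ _)).1
      linarith [hpos e]
    have heq : G.incidence.mulVec (x + s • y) = 1 := by
      rw [Matrix.mulVec_add, Matrix.mulVec_smul, hy0, smul_zero, add_zero, hx.2.2]
    have hmem : x + s • y ∈ G.fractional := by
      refine ⟨h0, fun e => ?_, heq⟩
      by_cases he : ∀ v : V, Sum.inl v ∉ G.ends e
      · exact (hbound' e he s (by rw [abs_of_pos hspos]; exact min_le_right _ _)).2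
      · push Not at he
        obtain ⟨v, hv⟩ := he
        have hsum : ∑ f, G.incidence v f * (x + s • y) f = 1 := congrFun heq v
        have hle : G.incidence v e * (x + s • y) e ≤ ∑ f, G.incidence v f * (x + s • y) f :=
          Finset.single_le_sum (f := fun f => G.incidence v f * (x + s • y) f)
            (fun f _ => mul_nonneg (incidence_nonneg v f) (h0 f)) (Finset.mem_univ e)
        have hi : G.incidence v e = 1 := by simp [incidence, hv]
        rwa [hsum, hi, one_mul] at hle
    have := AffineSubspace.vsub_mem_direction (subset_affineSpan ℝ _ hmem)
      (subset_affineSpan ℝ _ hx)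
    rw [vsub_eq_sub, add_sub_cancel_left] at this
    exact (Submodule.smul_mem_iff _ hspos.ne').1 this

end PlaneBipartiteGraph

theorem mainTheorem5 {n : ℕ} {V E : Type*} [Finite V] [Finite E]
    (G : PlaneBipartiteGraph n V E)
    (hG : ∃ M : Set E, G.IsAlmostPerfectMatching M)
    (hE : ∀ e : E, ∃ M : Set E, G.IsAlmostPerfectMatching M ∧ e ∈ M) :
    Finite G.Faces ∧ (G.polytopeDim : ℤ) = (Nat.card G.Faces : ℤ) - 1 := by
  cases nonempty_fintype V
  cases nonempty_fintype E
  have hV : ∀ v, ∃ e, Sum.inl v ∈ G.ends e := fun v => by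
    obtain ⟨M, hM⟩ := hG
    obtain ⟨e, ⟨-, he⟩, -⟩ := hM v
    exact ⟨e, he⟩
  obtain ⟨hfin, hcard⟩ := G.card_faces_eq hV
  refine ⟨hfin, ?_⟩
  have h1 : G.polytopeDim + G.incidence.rank = Fintype.card E := by
    rw [PlaneBipartiteGraph.polytopeDim,
      PlaneBipartiteGraph.direction_affineSpan_matchingPolytope hG hE, add_comm, Matrix.rank,
      LinearMap.finrank_range_add_finrank_ker, Module.finrank_fintype_fun_eq_card]
  have h2 := (G.coboundary ℝ).range.finrank_quotient_add_finrank
  rw [Module.finrank_fintype_fun_eq_card, ← G.rank_incidence] at h2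
  omega
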